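/- Fix a universe $\mathbb U$ (with an element of infinite cardinality). A $\mathbb U$-site is a site whose Hom sets are $\mathbb U$-small and which has a $\mathbb U$-small topologically generating set of objects, i.e. one such that every object is covered by morphisms from members of the set. **Setting.** Let $I$ be a $\mathbb U$-site in which fibre products exist, and let $\pi\colon E\to I$ be a cloven fibred category such that each fibre $E_i$ ($i\in \mathrm{Ob}(I)$) has finite limits and is endowed with a topology making it a $\mathbb U$-site, and such that for every morphism $f\colon i\to j$ of $I$ the inverse image functor $f^+\colon E_j\to E_i$ is continuous and left exact. Let $\widetilde E_i$ be the topos of sheaves of $\mathbb U$-sets on $E_i$; then $f$ defines a morphism of toposes $f\colon\widetilde E_i\to\widetilde E_j$ with $f_*(F)=F\circ f^+$ and $f^*$ left adjoint to $f_*$. The co-vanishing topology on $E$ is the topology generated by the families $(V_n\to V)_n$ of the following two kinds: (v) covering families of a fibre $E_i$, $i\in \mathrm{Ob}(I)$; (c) families of cartesian morphisms $f_n^+(V)\to V$, where $V$ is an object of $E$ over $i\in\mathrm{Ob}(I)$ and $(f_n\colon i_n\to i)_n$ is a covering family of $I$. The generalized co-vanishing topos $\widetilde E$ is the topos of sheaves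 of $\mathbb U$-sets on $E$ for this topology. **Terminology.** An object of a site is quasi-compact if every covering family of it contains a finite covering subfamily; the objects of a topos are considered with respect to the canonical topology (covering = epimorphic families). An object $X$ of a topos is quasi-separated if $S\times_X S'$ is quasi-compact for all quasi-compact objects $S,S'$ over $X$, and coherent if it is quasi-compact and quasi-separated. A morphism $X\to Y$ of a topos is quasi-compact if $X\times_Y S$ is quasi-compact for every $S\to Y$ with $S$ quasi-compact; $X$ is quasi-separated over $Y$ if the diagonal $X\to X\times_Y X$ is quasi-compact. A topos is coherent if its final object $e$ is coherent and it has a generating full subcategory of coherent objects that are quasi-separated over $e$. A topos is locally coherent if its final object is covered by objects $X$ such that the slice topos over $X$ is coherent. A morphism $f$ between coherent toposes is coherent if $f^*$ sends coherent objects to coherent objects. **Proposition 5.16.** Suppose that 1. there is a $\mathbb U$-small topologically generating full subcategory $I'$ of $I$, consisting of quasi-compact objects of $I$ and stable under fibre products; 2. for every object $i$ of $I'$, the topos $\widetilde E_i$ is coherent; 3. for every morphism $f\colon i\to j$ of $I'$, the morphism of toposes $f\colon\widetilde E_i\to\widetilde E_j$ is coherent. Then the topos $\widetilde E$ is locally coherent.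 If moreover $I$ has a final object that belongs to $I'$, then $\widetilde E$ is coherent. -/

import Mathlib

open CategoryTheory CategoryTheory.Limits

universe w u₁ u₂

namespace Covanishing

/-! ### Sites relative to a universe -/

section Sites

universe v u v' u'

/-- A `w`-site: a category with `w`-small sets of morphisms, with a topology for which there is
a `w`-small topologically generating set `G` of objects (every object is covered by morphisms
with sources in `G`). The category may have more than `w`-many objects. -/
def IsUSite {C : Type u} [Category.{w} C] (J : GrothendieckTopology C) : Prop :=
  ∃ G : ObjectProperty C, ObjectProperty.Small.{w} G ∧ G.ι.IsCoverDense J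

/-- An object of a site is quasi-compact if every covering family of it contains a finite
covering subfamily. Families of morphisms with target `X` are given as presieves; a family
is covering if it generates a covering sieve. -/
def IsQuasiCompactInSite {C : Type u} [Category.{v} C] (J : GrothendieckTopology C) (X : C) :
    Prop :=
  ∀ R : Presieve X, Sieve.generate R ∈ J X →
    ∃ R' : Presieve X, R' ≤ R ∧ R'.uncurry.Finite ∧ Sieve.generate R' ∈ J X

section Comparison

variable {C : Type u} [Category.{w} C] [HasPullbacks C] (J : GrothendieckTopology C)
  (G : ObjectProperty C) [ObjectProperty.Small.{w} G] [G.ι.IsCoverDense J]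

/-- A small topologically generating full subcategory has the same sheaves of sets. -/
theorem isEquivalence_restriction :
    (G.ι.sheafPushforwardContinuous (Type w) (G.ι.restrictedTopology J) J).IsEquivalence := by
  have : Functor.IsOneHypercoverDense.{w} G.ι (G.ι.restrictedTopology J) J := by
    refine Functor.IsOneHypercoverDense.of_hasPullbacks (fun S ↦ ?_)
    let T : Type w := Shrink.{w} (Σ X : G.FullSubcategory, (G.ι.obj X ⟶ S))
    let e : T ≃ (Σ X : G.FullSubcategory, (G.ι.obj X ⟶ S)) := (equivShrink _).symm
    refine ⟨T, fun t ↦ (e t).1, fun t ↦ (e t).2, ?_⟩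
    refine J.superset_covering ?_ (G.ι.is_cover_of_isCoverDense J S)
    rintro Y f ⟨⟨Z, lift, map, fac⟩⟩
    obtain ⟨t, ht⟩ := e.surjective ⟨Z, map⟩
    rw [Sieve.mem_ofArrows_iff]
    have key : ∀ x : (Σ X : G.FullSubcategory, (G.ι.obj X ⟶ S)), x = ⟨Z, map⟩ →
        ∃ a : Y ⟶ G.ι.obj x.1, f = a ≫ x.2 := by
      rintro _ rfl
      exact ⟨lift, fac.symm⟩
    exact ⟨t, key _ ht⟩
  exact Functor.isEquivalence_of_isOneHypercoverDense.{w} _ _ _ _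

end Comparison

/-- Sheaves of `w`-sets on a `w`-site with fibre products admit sheafification. -/
theorem IsUSite.hasSheafify {C : Type u} [Category.{w} C] [HasPullbacks C]
    {J : GrothendieckTopology C} (hJ : IsUSite J) : HasSheafify J (Type w) := by
  obtain ⟨G, _, _⟩ := hJ
  have : HasSheafify (G.ι.restrictedTopology J) (Type w) :=
    hasSheafifyEssentiallySmallSite.{w, w, u, w + 1, w} _ _
  have := isEquivalence_restriction J G
  exact Functor.IsDenseSubsite.hasSheafify_of_isEquivalence (G.ι.restrictedTopology J) J G.ι

/-- For a continuous functor between `w`-sites, the direct image functor on sheaves of `w`-sets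
has a left adjoint. -/
theorem IsUSite.isRightAdjoint {C : Type u} [Category.{w} C] [HasPullbacks C]
    {J : GrothendieckTopology C} (hJ : IsUSite J)
    {D : Type u'} [Category.{w} D] [HasPullbacks D]
    {K : GrothendieckTopology D} (hK : IsUSite K) (F : C ⥤ D) [F.IsContinuous J K] :
    (F.sheafPushforwardContinuous (Type w) J K).IsRightAdjoint := by
  have := hK.hasSheafify
  obtain ⟨G, _, _⟩ := hJ
  have := isEquivalence_restriction J G
  let ρ := G.ι.sheafPushforwardContinuous (Type w) (G.ι.restrictedTopology J) J
  let p := F.sheafPushforwardContinuous (Type w) J K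
  have : (G.ι ⋙ F).IsContinuous (G.ι.restrictedTopology J) K :=
    Functor.isContinuous_comp G.ι F _ J K
  have hcolim (X : Dᵒᵖ) : HasColimitsOfShape (CostructuredArrow (G.ι ⋙ F).op X) (Type w) :=
    hasColimitsOfShape_of_essentiallySmall.{w} _ _
  have (P : G.FullSubcategoryᵒᵖ ⥤ Type w) : (G.ι ⋙ F).op.HasLeftKanExtension P := by
    have : (G.ι ⋙ F).op.HasPointwiseLeftKanExtension P := fun X ↦ by
      have := hcolim X
      infer_instance
    infer_instance
  have : ((G.ι ⋙ F).sheafPushforwardContinuous (Type w)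
      (G.ι.restrictedTopology J) K).IsRightAdjoint := inferInstance
  have : (p ⋙ ρ).IsRightAdjoint := Functor.isRightAdjoint_of_iso
    (Functor.sheafPushforwardContinuousComp G.ι F (Type w) (G.ι.restrictedTopology J) J K).symm
  have : ((p ⋙ ρ) ⋙ ρ.inv).IsRightAdjoint := inferInstance
  exact Functor.isRightAdjoint_of_iso
    (Functor.associator p ρ ρ.inv ≪≫
      Functor.isoWhiskerLeft p ρ.asEquivalence.unitIso.symm ≪≫ p.rightUnitor)

end Sites

/-! ### Quasi-compactness and coherence in a topos

In this part `T` is meant to be a topos; it carries its canonical topology, for which the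
covering families are the (jointly) epimorphic ones. -/

section Topos

universe v u v' u'

/-- A family of morphisms with target `X` is epimorphic if two morphisms from `X` agree as soon
as their composites with all members of the family agree. -/
def IsEpimorphicFamily {T : Type u} [Category.{v} T] {X : T} (R : Presieve X) : Prop :=
  ∀ ⦃Z : T⦄ (a b : X ⟶ Z), (∀ ⦃Y : T⦄ (f : Y ⟶ X), R f → f ≫ a = f ≫ b) → a = b

/-- An object of a topos is quasi-compact if every epimorphic family with this target contains
a finite epimorphic subfamily. -/
def IsQuasiCompact {T : Type u} [Category.{v} T] (X : T) : Prop :=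
  ∀ R : Presieve X, IsEpimorphicFamily R →
    ∃ R' : Presieve X, R' ≤ R ∧ R'.uncurry.Finite ∧ IsEpimorphicFamily R'

variable {T : Type u} [Category.{v} T] [HasFiniteLimits T]

/-- An object `X` of a topos is quasi-separated if `S ×_X S'` is quasi-compact for all
quasi-compact objects `S`, `S'` over `X`. -/
def IsQuasiSeparated (X : T) : Prop :=
  ∀ ⦃S S' : T⦄ (f : S ⟶ X) (g : S' ⟶ X), IsQuasiCompact S → IsQuasiCompact S' →
    IsQuasiCompact (pullback f g)

/-- Coherent means quasi-compact and quasi-separated. -/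
def IsCoherent (X : T) : Prop :=
  IsQuasiCompact X ∧ IsQuasiSeparated X

/-- A morphism of a topos is quasi-compact if its base changes to quasi-compact objects have
quasi-compact source. -/
def IsQuasiCompactMorphism {X Y : T} (f : X ⟶ Y) : Prop :=
  ∀ ⦃S : T⦄ (g : S ⟶ Y), IsQuasiCompact S → IsQuasiCompact (pullback f g)

/-- A morphism of a topos is quasi-separated if its diagonal is quasi-compact. -/
def IsQuasiSeparatedMorphism {X Y : T} (f : X ⟶ Y) : Prop :=
  IsQuasiCompactMorphism (pullback.diagonal f)

variable (T)

/-- A topos is algebraic if it has a generating full subcategory consisting of coherent objects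
which are quasi-separated over the final object. -/
def IsAlgebraicTopos : Prop :=
  ∃ G : ObjectProperty T, G.IsSeparating ∧
    ∀ X, G X → IsCoherent X ∧ IsQuasiSeparatedMorphism (terminal.from X)

/-- A topos is coherent if it is algebraic and its final object is coherent. -/
def IsCoherentTopos : Prop :=
  IsAlgebraicTopos T ∧ IsCoherent (⊤_ T)

/-- A topos `T` is locally coherent if its final object can be covered by objects `X` such that
the topos `T / X` is coherent. -/
def IsLocallyCoherentTopos : Prop :=
  ∃ R : Presieve (⊤_ T), IsEpimorphicFamily R ∧
    ∀ ⦃X : T⦄ (f : X ⟶ ⊤_ T), R f → IsCoherentTopos (Over X)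

variable {T}

/-- A morphism of toposes with inverse image functor `u` is coherent if `u` sends coherent
objects to coherent objects. -/
def IsCoherentInverseImage {T' : Type u'} [Category.{v'} T'] [HasFiniteLimits T']
    (u : T ⥤ T') : Prop :=
  ∀ X : T, IsCoherent X → IsCoherent (u.obj X)

end Topos

/-! ### Fibred sites -/

section Fibred

variable {I : Type u₁} [Category.{w} I] {E : Type u₂} [Category.{w} E]

/-- A cleavage of a fibred category `π : E ⥤ I`: for all `f : i ⟶ j` in `I` and all objects `V`
of the fibre over `j`, a chosen cartesian morphism `f⁺ V ⟶ V` over `f`. -/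
structure Cleavage (π : E ⥤ I) where
  /-- the object `f⁺ V` of the fibre over `i` -/
  obj {i j : I} (f : i ⟶ j) (V : π.Fiber j) : π.Fiber i
  /-- the cartesian morphism `f⁺ V ⟶ V` -/
  lift {i j : I} (f : i ⟶ j) (V : π.Fiber j) : (obj f V).1 ⟶ V.1
  isCartesian {i j : I} (f : i ⟶ j) (V : π.Fiber j) : π.IsCartesian f (lift f V)

attribute [instance] Cleavage.isCartesian

namespace Cleavage

variable {π : E ⥤ I} (c : Cleavage π) {i j : I} (f : i ⟶ j)

instance isHomLift_lift_comp {V W : π.Fiber j} (φ : V ⟶ W) :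
    π.IsHomLift f (c.lift f V ≫ φ.1) := by
  have := φ.2
  infer_instance

/-- The inverse image functor `f⁺ : E_j ⥤ E_i` of a cloven fibred category. -/
noncomputable def pullbackFunctor : π.Fiber j ⥤ π.Fiber i where
  obj V := c.obj f V
  map {V W} φ := ⟨Functor.IsCartesian.map π f (c.lift f W) (c.lift f V ≫ φ.1), inferInstance⟩
  map_id V := by
    apply Subtype.ext
    symm
    have : π.IsHomLift (𝟙 i) (Subtype.val (𝟙 (c.obj f V))) := Subtype.property (𝟙 (c.obj f V))
    refine Functor.IsCartesian.map_uniq π f (c.lift f V) (c.lift f V ≫ (𝟙 V : V ⟶ V).1) _ ?_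
    exact (Category.id_comp _).trans (Category.comp_id _).symm
  map_comp {V W X} φ ψ := by
    apply Subtype.ext
    symm
    have h : π.IsHomLift (𝟙 i)
      (Functor.IsCartesian.map π f (c.lift f W) (c.lift f V ≫ φ.1) ≫
        Functor.IsCartesian.map π f (c.lift f X) (c.lift f W ≫ ψ.1)) := inferInstance
    refine Functor.IsCartesian.map_uniq π f (c.lift f X) _ _ ?_
    change (_ ≫ _) ≫ _ = c.lift f V ≫ φ.1 ≫ ψ.1
    simp

end Cleavage

/-- A cloven `w`-site fibred over `I`: a cloven fibred category `π : E ⥤ I` whose fibres,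
which have finite limits, are made into `w`-sites, and whose inverse image functors are continuous and left
exact. -/
structure FibredSite (π : E ⥤ I) [π.IsFibered] [∀ i, HasFiniteLimits (π.Fiber i)] where
  /-- the cleavage -/
  cleavage : Cleavage π
  /-- the topology of the fibre over `i` -/
  topology (i : I) : GrothendieckTopology (π.Fiber i)
  isUSite (i : I) : IsUSite (topology i)
  isContinuous {i j : I} (f : i ⟶ j) :
    (cleavage.pullbackFunctor f).IsContinuous (topology j) (topology i)
  isLeftExact {i j : I} (f : i ⟶ j) : PreservesFiniteLimits (cleavage.pullbackFunctor f)

namespace FibredSite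

attribute [instance] isContinuous isLeftExact

variable {π : E ⥤ I} [π.IsFibered] [∀ i, HasFiniteLimits (π.Fiber i)] (S : FibredSite π)

/-- The topos of sheaves of `w`-sets on the fibre over `i`. -/
abbrev FibreTopos (i : I) := Sheaf (S.topology i) (Type w)

/-- The direct image functor of the morphism of toposes defined by `f : i ⟶ j`, which is
composition with `f⁺`. -/
noncomputable abbrev directImage {i j : I} (f : i ⟶ j) : S.FibreTopos i ⥤ S.FibreTopos j :=
  (S.cleavage.pullbackFunctor f).sheafPushforwardContinuous (Type w)
    (S.topology j) (S.topology i)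

instance isRightAdjoint_directImage {i j : I} (f : i ⟶ j) : (S.directImage f).IsRightAdjoint :=
  IsUSite.isRightAdjoint (S.isUSite j) (S.isUSite i) _

/-- The inverse image functor of the morphism of toposes defined by `f : i ⟶ j`, which is left
adjoint to the direct image functor. -/
noncomputable abbrev inverseImage {i j : I} (f : i ⟶ j) : S.FibreTopos j ⥤ S.FibreTopos i :=
  (S.cleavage.pullbackFunctor f).sheafPullback (Type w) (S.topology j) (S.topology i)

/-- The two types of families generating the co-vanishing topology on `E`. -/
inductive IsGeneratingFamily (K : GrothendieckTopology I) : (V : E) → Presieve V → Prop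
  /-- vertical families: covering families of an object of some fibre -/
  | vertical {i : I} (V : π.Fiber i) (R : Presieve V)
      (hR : Sieve.generate R ∈ S.topology i V) :
      IsGeneratingFamily K ((Functor.Fiber.fiberInclusion : π.Fiber i ⥤ E).obj V)
        (R.map (Functor.Fiber.fiberInclusion : π.Fiber i ⥤ E))
  /-- cartesian families: the cartesian morphisms `f⁺ V ⟶ V` over the members `f` of a covering
  family of the image of `V` in `I` -/
  | cartesian (V : E) (R : Presieve (π.obj V)) (hR : Sieve.generate R ∈ K (π.obj V)) :
      IsGeneratingFamily K V
        (fun _ g ↦ R (π.map g) ∧ π.IsCartesian (π.map g) g)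

/-- The co-vanishing topology on `E`: the coarsest topology for which the vertical and the
cartesian families are covering. -/
def covanishingTopology (K : GrothendieckTopology I) : GrothendieckTopology E :=
  Precoverage.toGrothendieck ⟨fun V ↦ {R | S.IsGeneratingFamily K V R}⟩

/-- The (generalized) co-vanishing topos: sheaves of `w`-sets on `E` for the co-vanishing
topology. -/
abbrev CovanishingTopos (K : GrothendieckTopology I) :=
  Sheaf (S.covanishingTopology K) (Type w)

end FibredSite

end Fibred

end Covanishing

/-! Let `extend i` be the left adjoint of the restriction of sheaves from E to the fibre E_i. The
sheaves `extend i X`, with i in I' and X coherent on E_i, play the role of the objects of a site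
with quasi-compact objects and fibre products. Call a morphism good if it is built from some f : i ⟶
k in I' and some X ⟶ f^*Z, through the canonical `trans` : extend i (f^*Z) ⟶ extend k Z. Then
everything rests on three facts, collected in `IsCoherentBasis`: these sheaves generate, and any
object over one of them is covered by others with good composites; they are quasi-compact; fibre
products of good morphisms are again of this form. Given them, each such sheaf is coherent: cover
two quasi-compact objects over it by finitely many basis members with good composites, and the
pieces of the fibre product are basis members. Applied to diagonals, this makes the slices over
basis members coherent, and the topos itself when its final object is in the basis.

Fibre products. The sheaf extend m (f^*Z) is the fibre product of extend k Z with `baseSheaf` m over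
`baseSheaf` k (`isPullback_trans`), because a map to f⁺V is a map to V together with a lift of its
base through f. Both `baseSheaf` and `extend` preserve fibre products; for `extend`, this holds
since the fibre inclusions preserve finite connected limits (`isPullback_sheafPullback_map`). Hence
the fibre product over i ⟶ k ⟵ j is the extension of a fibre product of inverse images on the fibre
over i ×_k j (`isPullback_extend`). It is coherent, as transition morphisms are coherent and
coherent objects of an algebraic topos are stable under fibre products (`isCoherent_pullback`).

Quasi-compactness (`isQuasiCompact_extend`). Given an epimorphic family, let N_L be the union of the
images of a finite subfamily L. A section s is controlled if every morphism from a coherent sheaf on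
a fibre over I' whose values locally come from s lands in a single N_L. Sections in the image of a
member are controlled, and being controlled is local for the co-vanishing topology: by induction on
its generation, vertical covers use quasi-compactness of coherent sheaves, and cartesian covers use
in addition quasi-compactness of the objects of I' and coherence of the transition morphisms. So all
sections are controlled, and quasi-compactness of X puts the unit of `extend i X` in one N_L. -/

namespace Covanishing

/-! ### Properties that hold on a covering sieve -/

section Locality

universe v u

variable {C : Type u} [Category.{v} C] (J : GrothendieckTopology C)

/-- A property of morphisms with target `U` holds locally if it holds on a covering sieve. -/
def Loc {U : C} (P : ∀ ⦃V : C⦄, (V ⟶ U) → Prop) : Prop :=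
  ∃ S ∈ J U, ∀ ⦃V : C⦄ (t : V ⟶ U), S t → P t

variable {J} {U : C} {P Q : ∀ ⦃V : C⦄, (V ⟶ U) → Prop}

lemma Loc.of_forall (h : ∀ ⦃V : C⦄ (t : V ⟶ U), P t) : Loc J P :=
  ⟨⊤, J.top_mem _, fun _ t _ ↦ h t⟩

lemma Loc.of_sieve {S : Sieve U} (hS : S ∈ J U) (h : ∀ ⦃V : C⦄ (t : V ⟶ U), S t → P t) :
    Loc J P := ⟨S, hS, h⟩

lemma Loc.mono (h : Loc J P) (hPQ : ∀ ⦃V : C⦄ (t : V ⟶ U), P t → Q t) : Loc J Q := by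
  obtain ⟨S, hS, h⟩ := h
  exact ⟨S, hS, fun _ t ht ↦ hPQ t (h t ht)⟩

lemma Loc.and (h : Loc J P) (h' : Loc J Q) : Loc J (fun _ t ↦ P t ∧ Q t) := by
  obtain ⟨S, hS, h⟩ := h
  obtain ⟨S', hS', h'⟩ := h'
  exact ⟨S ⊓ S', J.intersection_covering hS hS', fun _ t ht ↦ ⟨h t ht.1, h' t ht.2⟩⟩

lemma Loc.pullback (h : Loc J P) {V : C} (g : V ⟶ U) : Loc J (fun _ t ↦ P (t ≫ g)) := by
  obtain ⟨S, hS, h⟩ := h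
  exact ⟨S.pullback g, J.pullback_stable g hS, fun _ t ht ↦ h _ ht⟩

lemma Loc.bind (h : Loc J P)
    (h' : ∀ ⦃V : C⦄ (t : V ⟶ U), P t → Loc J (fun _ t' ↦ Q (t' ≫ t))) : Loc J Q := by
  obtain ⟨S, hS, h⟩ := h
  choose R hR hQ using fun (V : C) (t : V ⟶ U) (ht : S t) ↦ h' t (h t ht)
  refine ⟨Sieve.bind S.1 R, J.bind_covering hS (fun _ _ ht ↦ hR _ _ ht), ?_⟩
  rintro V _ ⟨W, g, f, hf, hg, rfl⟩
  exact hQ _ _ hf _ hg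

end Locality

/-! ### Sheaves of sets and epimorphic families in terms of sections -/

section Sections

universe v u t

variable {C : Type u} [Category.{v} C] {J : GrothendieckTopology C}

/-- The sections of a sheaf of sets on an object of the site. -/
def Sec (F : Sheaf J (Type t)) (U : C) : Type t := F.obj.obj (Opposite.op U)

/-- Restriction of sections. -/
def res {F : Sheaf J (Type t)} {U V : C} (f : V ⟶ U) (s : Sec F U) : Sec F V := F.obj.map f.op s

/-- The action of a morphism of sheaves on sections. -/
def ev {F G : Sheaf J (Type t)} (φ : F ⟶ G) {U : C} (s : Sec F U) : Sec G U :=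
  φ.hom.app (Opposite.op U) s

variable {F G H : Sheaf J (Type t)} {U V W : C}

@[simp]
lemma res_id (s : Sec F U) : res (𝟙 U) s = s := by
  exact ConcreteCategory.congr_hom (F.obj.map_id (Opposite.op U)) s

@[simp]
lemma res_res (f : V ⟶ U) (g : W ⟶ V) (s : Sec F U) : res g (res f s) = res (g ≫ f) s :=
  (ConcreteCategory.congr_hom (F.obj.map_comp f.op g.op) s).symm

@[simp]
lemma ev_comp (φ : F ⟶ G) (ψ : G ⟶ H) (s : Sec F U) : ev (φ ≫ ψ) s = ev ψ (ev φ s) := rfl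

@[simp]
lemma ev_res (φ : F ⟶ G) (f : V ⟶ U) (s : Sec F U) : ev φ (res f s) = res f (ev φ s) :=
  ConcreteCategory.congr_hom (φ.hom.naturality f.op) s

lemma sheaf_hom_ext {φ ψ : F ⟶ G} (h : ∀ (U : C) (s : Sec F U), ev φ s = ev ψ s) : φ = ψ := by
  apply ObjectProperty.hom_ext
  ext U s
  exact h U.unop s

/-- A morphism of sheaves from its action on sections. -/
def homOfSec (f : ∀ U : C, Sec F U → Sec G U)
    (hf : ∀ ⦃U V : C⦄ (g : V ⟶ U) (s : Sec F U), f V (res g s) = res g (f U s)) : F ⟶ G :=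
  ⟨{ app U := ↾(f U.unop)
     naturality U V g := by
      ext s
      exact hf g.unop s }⟩

@[simp]
lemma ev_homOfSec (f : ∀ U : C, Sec F U → Sec G U)
    (hf : ∀ ⦃U V : C⦄ (g : V ⟶ U) (s : Sec F U), f V (res g s) = res g (f U s)) (s : Sec F U) :
    ev (homOfSec f hf) s = f U s := rfl

lemma sec_ext {s s' : Sec F U} (h : Loc J (fun _ t ↦ res t s = res t s')) : s = s' := by
  obtain ⟨S, hS, h⟩ := h
  exact (((isSheaf_iff_isSheaf_of_type J F.obj).1 F.property) S hS).isSeparatedFor.ext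
    (fun V f hf ↦ h f hf)

/-- Uniqueness makes arbitrary local choices compatible. Since `Q` is not assumed to be local, the
glued section has it only locally. -/
lemma exists_glue (Q : ∀ ⦃V : C⦄, (V ⟶ U) → Sec F V → Prop)
    (hQ : ∀ ⦃V W : C⦄ (t : V ⟶ U) (g : W ⟶ V) (s : Sec F V), Q t s → Q (g ≫ t) (res g s))
    (ex : Loc J (fun V t ↦ ∃ s : Sec F V, Q t s))
    (uniq : ∀ ⦃V : C⦄ (t : V ⟶ U) (s s' : Sec F V), Q t s → Q t s' → s = s') :
    ∃ s : Sec F U, Loc J (fun _ t ↦ Q t (res t s)) := by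
  obtain ⟨S, hS, h⟩ := ex
  choose x hx using fun (V : C) (t : V ⟶ U) (ht : S t) ↦ h t ht
  have hc : Presieve.FamilyOfElements.Compatible (P := F.obj) (R := S.arrows) x := by
    intro V₁ V₂ W g₁ g₂ f₁ f₂ h₁ h₂ e
    refine uniq (g₁ ≫ f₁) _ _ (hQ _ g₁ _ (hx _ _ h₁)) ?_
    rw [e]
    exact hQ _ g₂ _ (hx _ _ h₂)
  obtain ⟨s, hs⟩ : ∃ s : Sec F U, ∀ (V : C) (t : V ⟶ U) (ht : S t), res t s = x V t ht := by
    obtain ⟨s, hs, -⟩ := ((isSheaf_iff_isSheaf_of_type J F.obj).1 F.property) S hS x hc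
    exact ⟨s, fun V t ht ↦ hs t ht⟩
  refine ⟨s, S, hS, fun V t ht ↦ ?_⟩
  beta_reduce
  rw [hs V t ht]
  exact hx V t ht

/-- A square of sheaves is cartesian if it is so locally on sections. -/
lemma isPullback_of_sections {P X Y Z : Sheaf J (Type t)} {p : P ⟶ X} {q : P ⟶ Y} {f : X ⟶ Z}
    {g : Y ⟶ Z} (comm : p ≫ f = q ≫ g)
    (inj : ∀ ⦃U : C⦄ (s s' : Sec P U), ev p s = ev p s' → ev q s = ev q s' →
      Loc J (fun _ t ↦ res t s = res t s'))
    (surj : ∀ ⦃U : C⦄ (x : Sec X U) (y : Sec Y U), ev f x = ev g y →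
      Loc J (fun V t ↦ ∃ s : Sec P V, ev p s = res t x ∧ ev q s = res t y)) :
    IsPullback p q f g := by
  -- Local injectivity provides the uniqueness needed to glue the local lifts, so global lifts
  -- exist. The universal morphism is then defined by choosing one on each object.
  have key : ∀ ⦃U : C⦄ (x : Sec X U) (y : Sec Y U), ev f x = ev g y →
      ∃ s : Sec P U, ev p s = x ∧ ev q s = y := by
    intro U x y hxy
    obtain ⟨s, hs⟩ := exists_glue (F := P)
      (fun V t s ↦ ev p s = res t x ∧ ev q s = res t y)
      (fun V W t g s h ↦ ⟨by simp [h.1], by simp [h.2]⟩) (surj x y hxy)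
      (fun V t s s' h h' ↦ sec_ext (inj s s' (h.1.trans h'.1.symm) (h.2.trans h'.2.symm)))
    exact ⟨s, sec_ext (hs.mono fun V t h ↦ by rw [← ev_res, h.1]),
      sec_ext (hs.mono fun V t h ↦ by rw [← ev_res, h.2])⟩
  refine ⟨⟨comm⟩, ⟨PullbackCone.IsLimit.mk comm
    (fun s ↦ homOfSec (fun U x ↦ (key (ev s.fst x) (ev s.snd x)
      (by rw [← ev_comp, s.condition, ev_comp])).choose) ?_) ?_ ?_ ?_⟩⟩
  · intro U V t x
    apply sec_ext
    have h₁ := (key (ev s.fst (res t x)) (ev s.snd (res t x))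
      (by rw [← ev_comp, s.condition, ev_comp])).choose_spec
    have h₂ := (key (ev s.fst x) (ev s.snd x)
      (by rw [← ev_comp, s.condition, ev_comp])).choose_spec
    apply inj
    · rw [h₁.1, ev_res, ev_res, h₂.1]
    · rw [h₁.2, ev_res, ev_res, h₂.2]
  · intro s
    apply sheaf_hom_ext
    intro U x
    rw [ev_comp, ev_homOfSec]
    exact (key (ev s.fst x) (ev s.snd x) (by rw [← ev_comp, s.condition, ev_comp])).choose_spec.1
  · intro s
    apply sheaf_hom_ext
    intro U x
    rw [ev_comp, ev_homOfSec]
    exact (key (ev s.fst x) (ev s.snd x) (by rw [← ev_comp, s.condition, ev_comp])).choose_spec.2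
  · intro s m hm hm'
    apply sheaf_hom_ext
    intro U x
    rw [ev_homOfSec]
    have h := (key (ev s.fst x) (ev s.snd x)
      (by rw [← ev_comp, s.condition, ev_comp])).choose_spec
    apply sec_ext
    apply inj
    · rw [h.1, ← hm, ev_comp]
    · rw [h.2, ← hm', ev_comp]

/-- A subpresheaf of a sheaf to which sections belong as soon as they do locally. -/
structure ClosedSub (F : Sheaf J (Type t)) where
  /-- the sections that belong to the subpresheaf -/
  mem {U : C} : Sec F U → Prop
  res_mem {U V : C} (f : V ⟶ U) {s : Sec F U} : mem s → mem (res f s)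
  of_loc {U : C} {s : Sec F U} : Loc J (fun _ t ↦ mem (res t s)) → mem s

namespace ClosedSub

/-- The underlying subfunctor. -/
def subfunctor (N : ClosedSub F) : Subfunctor F.obj where
  obj U := { s | N.mem (U := U.unop) s }
  map i _ hs := N.res_mem i.unop hs

/-- A closed subpresheaf as a sheaf. -/
def sheaf (N : ClosedSub F) : Sheaf J (Type t) where
  obj := N.subfunctor.toFunctor
  property := by
    rw [isSheaf_iff_isSheaf_of_type,
      Subfunctor.isSheaf_iff _ ((isSheaf_iff_isSheaf_of_type J F.obj).1 F.property)]
    exact fun U s hs ↦ N.of_loc (Loc.of_sieve hs (fun _ _ h ↦ h))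

/-- The inclusion of a closed subpresheaf. -/
def ι (N : ClosedSub F) : N.sheaf ⟶ F := ⟨N.subfunctor.ι⟩

/-- A morphism with image contained in a closed subpresheaf. -/
def lift (N : ClosedSub F) (φ : G ⟶ F) (h : ∀ ⦃U : C⦄ (s : Sec G U), N.mem (ev φ s)) :
    G ⟶ N.sheaf :=
  homOfSec (fun _ s ↦ ⟨ev φ s, h s⟩) (fun _ _ g s ↦ Subtype.ext (ev_res φ g s))

@[simp]
lemma lift_ι (N : ClosedSub F) (φ : G ⟶ F) (h : ∀ ⦃U : C⦄ (s : Sec G U), N.mem (ev φ s)) :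
    N.lift φ h ≫ N.ι = φ := rfl

lemma mem_ev_ι (N : ClosedSub F) (s : Sec N.sheaf U) : N.mem (ev N.ι s) := s.2

lemma ev_ι_injective (N : ClosedSub F) {s s' : Sec N.sheaf U} (h : ev N.ι s = ev N.ι s') :
    s = s' := Subtype.ext h

/-- This turns universal properties into induction on generators: a map from a universal object to a
closed subsheaf containing its generators splits the inclusion, so every section lies in the
subsheaf. -/
lemma mem_of_section (N : ClosedSub F) (r : F ⟶ N.sheaf) (hr : r ≫ N.ι = 𝟙 F) (s : Sec F U) :
    N.mem s := by
  have h := N.mem_ev_ι (ev r s)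
  rwa [← ev_comp, hr] at h

/-- The sections which locally have a property. -/
def ofLoc (P : ∀ ⦃U : C⦄, Sec F U → Prop) : ClosedSub F where
  mem s := Loc J (fun _ t ↦ P (res t s))
  res_mem f s hs := (hs.pullback f).mono (fun _ t h ↦ by simpa using h)
  of_loc h := h.bind (fun _ t ht ↦ ht.mono (fun _ t' h' ↦ by simpa using h'))

lemma mem_ofLoc_of {P : ∀ ⦃U : C⦄, Sec F U → Prop}
    (hP : ∀ ⦃U V : C⦄ (f : V ⟶ U) (s : Sec F U), P s → P (res f s)) {s : Sec F U} (hs : P s) :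
    (ofLoc P).mem s := Loc.of_forall (fun _ t ↦ hP t s hs)

instance (N : ClosedSub F) : Mono N.ι where
  right_cancellation a b h := by
    apply sheaf_hom_ext
    intro U s
    apply N.ev_ι_injective
    rw [← ev_comp, h, ev_comp]

end ClosedSub

/-- An epimorphic family of sheaves with values in a closed subsheaf: the subsheaf is everything. -/
lemma mem_of_isEpimorphicFamily [HasSheafify J (Type t)] {R : Presieve F}
    (hR : IsEpimorphicFamily R) (N : ClosedSub F)
    (hN : ∀ ⦃G : Sheaf J (Type t)⦄ (φ : G ⟶ F), R φ → ∀ ⦃U : C⦄ (s : Sec G U), N.mem (ev φ s))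
    (s : Sec F U) : N.mem s := by
  -- The family factors through the inclusion, which is thus epimorphic as well as monomorphic, and
  -- sheaves of sets form a balanced category.
  have : Epi N.ι := ⟨fun a b h ↦ hR a b (fun Y f hf ↦ by
    rw [← N.lift_ι f (hN f hf), Category.assoc, h, Category.assoc])⟩
  have : IsIso N.ι := isIso_of_mono_of_epi _
  exact N.mem_of_section (inv N.ι) (IsIso.inv_hom_id _) s

/-- The sections that lift locally form a closed subsheaf through which the family factors. With the
next lemma, this identifies epimorphic with locally surjective families. -/
lemma loc_of_isEpimorphicFamily [HasSheafify J (Type t)] {R : Presieve F}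
    (hR : IsEpimorphicFamily R) (s : Sec F U) :
    Loc J (fun V f ↦ ∃ (G : Sheaf J (Type t)) (φ : G ⟶ F) (_ : R φ) (y : Sec G V),
      ev φ y = res f s) := by
  refine mem_of_isEpimorphicFamily hR (ClosedSub.ofLoc
    (fun V s ↦ ∃ (G : Sheaf J (Type t)) (φ : G ⟶ F) (_ : R φ) (y : Sec G V), ev φ y = s)) ?_ s
  intro G φ hφ U s
  refine ClosedSub.mem_ofLoc_of ?_ ⟨G, φ, hφ, s, rfl⟩
  rintro U V f s ⟨G, φ, hφ, y, rfl⟩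
  exact ⟨G, φ, hφ, res f y, by simp⟩

lemma isEpimorphicFamily_of_loc {R : Presieve F}
    (h : ∀ ⦃U : C⦄ (s : Sec F U), Loc J (fun V f ↦ ∃ (G : Sheaf J (Type t)) (φ : G ⟶ F) (_ : R φ)
      (y : Sec G V), ev φ y = res f s)) : IsEpimorphicFamily R := by
  intro Z a b hab
  apply sheaf_hom_ext
  intro U s
  apply sec_ext
  refine (h s).mono ?_
  rintro V f ⟨G, φ, hφ, y, hy⟩
  rw [← ev_res, ← ev_res, ← hy, ← ev_comp, ← ev_comp, hab φ hφ]

end Sections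

/-! ### Sheaves associated with representable presheaves -/

section Representable

universe u

variable {C : Type u} [Category.{w} C] (J : GrothendieckTopology C) [HasSheafify J (Type w)]

/-- The sheaf associated with the presheaf represented by an object. -/
noncomputable def eps (U : C) : Sheaf J (Type w) := (presheafToSheaf J (Type w)).obj (yoneda.obj U)

/-- The universal section of a representable sheaf. -/
noncomputable def genSec (U : C) : Sec (eps J U) U :=
  (toSheafify J (yoneda.obj U)).app (Opposite.op U) (𝟙 U)

variable {J} {F G : Sheaf J (Type w)} {U V : C}

/-- The morphism defined by a section. -/
noncomputable def ofSec (s : Sec F U) : eps J U ⟶ F :=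
  ((sheafificationAdjunction J (Type w)).homEquiv _ _).symm (yonedaEquiv.symm s)

@[simp]
lemma ev_ofSec (s : Sec F U) : ev (ofSec s) (genSec J U) = s := by
  have h := ((sheafificationAdjunction J (Type w)).homEquiv _ _).apply_symm_apply
    (yonedaEquiv.symm s : yoneda.obj U ⟶ F.obj)
  rw [Adjunction.homEquiv_unit] at h
  have h' := ConcreteCategory.congr_hom (congr_app h (Opposite.op U)) (𝟙 U)
  refine Eq.trans ?_ (h'.trans (yonedaEquiv.apply_symm_apply (s : F.obj.obj (Opposite.op U))))
  rfl

lemma eps_hom_ext {φ ψ : eps J U ⟶ F} (h : ev φ (genSec J U) = ev ψ (genSec J U)) : φ = ψ := by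
  apply ((sheafificationAdjunction J (Type w)).homEquiv _ _).injective
  apply yonedaEquiv.injective
  exact h

@[simp]
lemma ofSec_comp (s : Sec F U) (φ : F ⟶ G) : ofSec s ≫ φ = ofSec (ev φ s) :=
  eps_hom_ext (by simp)

/-- The universal section lies in the closed subsheaf of sections that are locally its restrictions,
and it generates the sheaf. -/
lemma loc_eps (y : Sec (eps J U) V) :
    Loc J (fun W t ↦ ∃ u : W ⟶ U, res t y = res u (genSec J U)) := by
  let N : ClosedSub (eps J U) := ClosedSub.ofLoc (fun W y ↦ ∃ u : W ⟶ U, y = res u (genSec J U))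
  have hg : N.mem (genSec J U) := ClosedSub.mem_ofLoc_of (by
    rintro W W' f _ ⟨u, rfl⟩
    exact ⟨f ≫ u, by simp⟩) ⟨𝟙 U, by simp⟩
  let g : Sec N.sheaf U := ⟨genSec J U, hg⟩
  exact N.mem_of_section (ofSec g) (eps_hom_ext (by
    rw [ev_comp, ev_ofSec]
    rfl)) y

/-- The pullback of an epimorphic family of sheaves. -/
lemma isEpimorphicFamily_pullback {R : Presieve F} (hR : IsEpimorphicFamily R) (g : G ⟶ F) :
    IsEpimorphicFamily (fun (Z : Sheaf J (Type w)) (h : Z ⟶ G) ↦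
      ∃ (W : Sheaf J (Type w)) (f : W ⟶ F) (_ : R f) (k : Z ⟶ W), h ≫ g = k ≫ f) := by
  apply isEpimorphicFamily_of_loc
  intro U s
  refine (loc_of_isEpimorphicFamily hR (ev g s)).mono ?_
  rintro V f ⟨W, φ, hφ, y, hy⟩
  exact ⟨eps J V, ofSec (res f s), ⟨W, φ, hφ, ofSec y, by simp [hy]⟩, genSec J V, by simp⟩

/-- The sections of a fibre product of sheaves. -/
lemma exists_sec_of_isPullback {P X Y Z : Sheaf J (Type w)} {p : P ⟶ X} {q : P ⟶ Y} {f : X ⟶ Z}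
    {g : Y ⟶ Z} (h : IsPullback p q f g) (x : Sec X U) (y : Sec Y U) (hxy : ev f x = ev g y) :
    ∃ s : Sec P U, ev p s = x ∧ ev q s = y := by
  refine ⟨ev (h.lift (ofSec x) (ofSec y) (by simp [hxy])) (genSec J U), ?_, ?_⟩
  · rw [← ev_comp, h.lift_fst, ev_ofSec]
  · rw [← ev_comp, h.lift_snd, ev_ofSec]

lemma sec_ext_of_isPullback {P X Y Z : Sheaf J (Type w)} {p : P ⟶ X} {q : P ⟶ Y} {f : X ⟶ Z}
    {g : Y ⟶ Z} (h : IsPullback p q f g) {s s' : Sec P U} (hp : ev p s = ev p s')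
    (hq : ev q s = ev q s') : s = s' := by
  have : ofSec s = ofSec s' := h.hom_ext (by simp [hp]) (by simp [hq])
  rw [← ev_ofSec s, this, ev_ofSec]

/-- If the sections of a sheaf locally have a property, then the sheaf is covered by the objects
of any separating class which map to it through representable sheaves of sections with this
property. -/
lemma isEpimorphicFamily_of_separating {A : ObjectProperty (Sheaf J (Type w))}
    (hA : A.IsSeparating) (Y : Sheaf J (Type w)) (P : ∀ ⦃W : C⦄, Sec Y W → Prop)
    (hP : ∀ ⦃W : C⦄ (y : Sec Y W), Loc J (fun _ t ↦ P (res t y))) :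
    IsEpimorphicFamily (fun (Y' : Sheaf J (Type w)) (φ : Y' ⟶ Y) ↦ A Y' ∧
      ∃ (W : C) (y : Sec Y W) (_ : P y) (ψ : Y' ⟶ eps J W), φ = ψ ≫ ofSec y) := by
  intro Z a b hab
  apply sheaf_hom_ext
  intro U s
  apply sec_ext
  refine (hP s).mono ?_
  intro V t ht
  have : ofSec (res t s) ≫ a = ofSec (res t s) ≫ b := by
    apply hA
    intro Y' hY' ψ
    rw [← Category.assoc, ← Category.assoc]
    exact hab _ ⟨hY', V, _, ht, ψ, rfl⟩
  rw [← ev_res, ← ev_res, ← ev_ofSec (ev a (res t s)), ← ev_ofSec (ev b (res t s)),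
    ← ofSec_comp, ← ofSec_comp, this]

end Representable

/-! ### Quasi-compact and coherent objects when epimorphic families are universal -/

section QuasiCompact

attribute [local simp] pullback.lift_fst pullback.lift_snd pullback.lift_fst_assoc
  pullback.lift_snd_assoc equalizer.lift_ι equalizer.lift_ι_assoc

universe v u

variable {T : Type u} [Category.{v} T]

/-- An indexed family of morphisms with the same target is jointly epimorphic. -/
def JointlyEpi {X : T} {ι : Type*} (Y : ι → T) (f : ∀ i, Y i ⟶ X) : Prop :=
  ∀ ⦃Z : T⦄ (a b : X ⟶ Z), (∀ i, f i ≫ a = f i ≫ b) → a = b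

variable (T) in
/-- Epimorphic families are stable under base change. -/
def EpiFamiliesUniversal : Prop :=
  ∀ ⦃X Y : T⦄ (R : Presieve X), IsEpimorphicFamily R → ∀ g : Y ⟶ X,
    IsEpimorphicFamily (fun (Z : T) (h : Z ⟶ Y) ↦
      ∃ (W : T) (f : W ⟶ X) (_ : R f) (k : Z ⟶ W), h ≫ g = k ≫ f)

lemma IsEpimorphicFamily.mono {X : T} {R R' : Presieve X} (hR : IsEpimorphicFamily R)
    (h : ∀ ⦃Y : T⦄ (f : Y ⟶ X), R f → R' f) : IsEpimorphicFamily R' :=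
  fun _ a b hab ↦ hR a b fun _ f hf ↦ hab f (h f hf)

lemma IsEpimorphicFamily.bind {X : T} {R R' : Presieve X} (hR : IsEpimorphicFamily R)
    (h : ∀ ⦃Y : T⦄ (f : Y ⟶ X), R f → ∃ Q : Presieve Y, IsEpimorphicFamily Q ∧
      ∀ ⦃Z : T⦄ (g : Z ⟶ Y), Q g → R' (g ≫ f)) : IsEpimorphicFamily R' := by
  intro Z a b hab
  refine hR a b fun Y f hf ↦ ?_
  obtain ⟨Q, hQ, hQ'⟩ := h f hf
  refine hQ _ _ fun W g hg ↦ ?_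
  simpa using hab _ (hQ' g hg)

lemma JointlyEpi.isEpimorphicFamily {X : T} {ι : Type*} {Y : ι → T} {f : ∀ i, Y i ⟶ X}
    (h : JointlyEpi Y f) : IsEpimorphicFamily (Presieve.ofArrows Y f) :=
  fun _ a b hab ↦ h a b fun i ↦ hab _ ⟨i⟩

lemma IsQuasiCompact.exists_finite {X : T} (hX : IsQuasiCompact X) {R : Presieve X}
    (hR : IsEpimorphicFamily R) :
    ∃ (n : ℕ) (Y : Fin n → T) (f : ∀ i, Y i ⟶ X), (∀ i, R (f i)) ∧ JointlyEpi Y f := by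
  obtain ⟨R', hR', hfin, hepi⟩ := hX R hR
  have := hfin.to_subtype
  obtain ⟨n, ⟨e⟩⟩ := Finite.exists_equiv_fin R'.uncurry
  refine ⟨n, fun i ↦ (e.symm i).1.1, fun i ↦ (e.symm i).1.2,
    fun i ↦ hR' _ _ (e.symm i).2, fun Z a b hab ↦ hepi a b fun Y f hf ↦ ?_⟩
  have key : ∀ x : R'.uncurry, x.1.2 ≫ a = x.1.2 ≫ b := fun x ↦ by
    obtain ⟨i, rfl⟩ := e.symm.surjective x
    exact hab i
  exact key ⟨⟨Y, f⟩, hf⟩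

lemma isQuasiCompact_of_exists_finite {X : T}
    (h : ∀ R : Presieve X, IsEpimorphicFamily R → ∃ (ι : Type) (_ : Finite ι) (Y : ι → T)
      (f : ∀ i, Y i ⟶ X), (∀ i, R (f i)) ∧ JointlyEpi Y f) : IsQuasiCompact X := by
  intro R hR
  obtain ⟨ι, _, Y, f, hf, hepi⟩ := h R hR
  refine ⟨Presieve.ofArrows Y f, ?_, ?_, hepi.isEpimorphicFamily⟩
  · rintro _ _ ⟨i⟩
    exact hf i
  · refine (Set.finite_range (fun i ↦ (⟨Y i, f i⟩ : Σ Z, Z ⟶ X))).subset ?_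
    rintro ⟨_, _⟩ ⟨i⟩
    exact ⟨i, rfl⟩

variable (hT : EpiFamiliesUniversal T)
include hT

lemma isQuasiCompact_of_jointlyEpi {X : T} {ι : Type} [Finite ι] {Y : ι → T} {f : ∀ i, Y i ⟶ X}
    (h : JointlyEpi Y f) (hY : ∀ i, IsQuasiCompact (Y i)) : IsQuasiCompact X := by
  apply isQuasiCompact_of_exists_finite
  intro R hR
  choose n Z g hg hgepi using fun i ↦ (hY i).exists_finite (hT R hR (f i))
  choose W r hr k hk using hg
  refine ⟨Σ i, Fin (n i), inferInstance, fun x ↦ W x.1 x.2, fun x ↦ r x.1 x.2,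
    fun x ↦ hr x.1 x.2, fun Z a b hab ↦ h a b fun i ↦ hgepi i _ _ fun j ↦ ?_⟩
  rw [← Category.assoc, hk, Category.assoc, hab ⟨i, j⟩, ← Category.assoc, ← hk, Category.assoc]

/-- A split epimorphism is a one-member epimorphic family. Identifications of finite limits below
therefore need only one of the two inverse laws. -/
lemma isQuasiCompact_of_retraction {X Y : T} (hY : IsQuasiCompact Y) (f : Y ⟶ X) (s : X ⟶ Y)
    (h : s ≫ f = 𝟙 X) : IsQuasiCompact X :=
  isQuasiCompact_of_jointlyEpi hT (ι := Unit) (Y := fun _ ↦ Y) (f := fun _ ↦ f)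
    (fun _ a b hab ↦ by
      rw [← Category.id_comp a, ← h, Category.assoc, hab (), ← Category.assoc, h,
        Category.id_comp]) (fun _ ↦ hY)

lemma isQuasiCompact_of_iso {X Y : T} (hY : IsQuasiCompact Y) (e : Y ≅ X) : IsQuasiCompact X :=
  isQuasiCompact_of_retraction hT hY e.hom e.inv e.inv_hom_id

variable [HasFiniteLimits T]

lemma jointlyEpi_pullback_left {X X' : T} {ι : Type*} {Y : ι → T} {f : ∀ i, Y i ⟶ X}
    (h : JointlyEpi Y f) (g : X' ⟶ X) :
    JointlyEpi (fun i ↦ pullback (f i) g) (fun i ↦ pullback.snd (f i) g) := by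
  intro Z a b hab
  refine hT _ h.isEpimorphicFamily g a b ?_
  rintro W p ⟨_, _, ⟨i⟩, k, hk⟩
  rw [← pullback.lift_snd k p hk.symm, Category.assoc, hab i, Category.assoc]

/-- Base change first along the cover of `S`, then along that of `S'`; the composites factor through
the fibre products of the pieces. -/
lemma jointlyEpi_pullback_map {X S S' : T} (f : S ⟶ X) (g : S' ⟶ X) {ι ι' : Type*}
    {Y : ι → T} {a : ∀ i, Y i ⟶ S} (ha : JointlyEpi Y a)
    {Y' : ι' → T} {b : ∀ i, Y' i ⟶ S'} (hb : JointlyEpi Y' b) :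
    JointlyEpi (fun x : ι × ι' ↦ pullback (a x.1 ≫ f) (b x.2 ≫ g))
      (fun x ↦ pullback.lift (f := f) (g := g) (pullback.fst (a x.1 ≫ f) (b x.2 ≫ g) ≫ a x.1)
        (pullback.snd (a x.1 ≫ f) (b x.2 ≫ g) ≫ b x.2)
        (by simp [pullback.condition])) := by
  intro Z u v huv
  refine jointlyEpi_pullback_left hT ha (pullback.fst f g) u v fun i ↦ ?_
  refine jointlyEpi_pullback_left hT hb
    (pullback.snd (a i) (pullback.fst f g) ≫ pullback.snd f g) _ _ fun j ↦ ?_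
  let l : pullback (b j) (pullback.snd (a i) (pullback.fst f g) ≫ pullback.snd f g) ⟶
      pullback (a i ≫ f) (b j ≫ g) :=
    pullback.lift (pullback.snd _ _ ≫ pullback.fst _ _) (pullback.fst _ _) (by
      simp only [Category.assoc]
      rw [pullback.condition_assoc, pullback.condition_assoc, pullback.condition]
      simp)
  have hl : pullback.snd (b j) (pullback.snd (a i) (pullback.fst f g) ≫ pullback.snd f g) ≫
      pullback.snd (a i) (pullback.fst f g) = l ≫ pullback.lift (pullback.fst _ _ ≫ a i)
        (pullback.snd _ _ ≫ b j) (by simp [pullback.condition]) := by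
    apply pullback.hom_ext
    · simp [l, pullback.condition]
    · simp [l, pullback.condition]
  rw [← Category.assoc, ← Category.assoc, hl]
  exact (Category.assoc _ _ _).trans ((congrArg (l ≫ ·) (huv (i, j))).trans
    (Category.assoc _ _ _).symm)

lemma isQuasiCompact_pullback_of_covers {X S S' : T} (f : S ⟶ X) (g : S' ⟶ X) {ι ι' : Type}
    [Finite ι] [Finite ι']
    {Y : ι → T} {a : ∀ i, Y i ⟶ S} (ha : JointlyEpi Y a)
    {Y' : ι' → T} {b : ∀ i, Y' i ⟶ S'} (hb : JointlyEpi Y' b)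
    (h : ∀ i j, IsQuasiCompact (pullback (a i ≫ f) (b j ≫ g))) :
    IsQuasiCompact (pullback f g) :=
  isQuasiCompact_of_jointlyEpi hT (jointlyEpi_pullback_map hT f g ha hb) (fun x ↦ h x.1 x.2)

lemma isQuasiCompact_of_isPullback {P X Y Z : T} {p : P ⟶ X} {q : P ⟶ Y} {f : X ⟶ Z} {g : Y ⟶ Z}
    (h : IsPullback p q f g) (hP : IsQuasiCompact (pullback f g)) : IsQuasiCompact P :=
  isQuasiCompact_of_iso hT hP h.isoPullback.symm

/-- In an algebraic topos, the equalizer of two morphisms from a quasi-compact object to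
a coherent object is quasi-compact. -/
lemma isQuasiCompact_equalizer (hA : IsAlgebraicTopos T) {Q Y : T} (hQ : IsQuasiCompact Q)
    (hY : IsCoherent Y) (a b : Q ⟶ Y) : IsQuasiCompact (equalizer a b) := by
  obtain ⟨G, hG, hG'⟩ := hA
  have hcov (X : T) : IsEpimorphicFamily (fun (Z : T) (_ : Z ⟶ X) ↦ G Z) :=
    fun _ a b hab ↦ hG _ _ fun Z hZ f ↦ hab f hZ
  -- Refine `Q` by finitely many generators on which `a` and `b` factor through generators `W` and
  -- `W'` over `Y`.
  obtain ⟨n, Z, g, hg, hepi⟩ := hQ.exists_finite (R := fun (Z : T) (g : Z ⟶ Q) ↦ G Z ∧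
      (∃ (W : T) (c : W ⟶ Y) (_ : G W) (k : Z ⟶ W), g ≫ a = k ≫ c) ∧
      (∃ (W : T) (c : W ⟶ Y) (_ : G W) (k : Z ⟶ W), g ≫ b = k ≫ c)) (by
    refine (hT _ (hcov Y) a).bind fun Z f ⟨W, c, hW, k, hk⟩ ↦
      ⟨_, (hT _ (hcov Y) (f ≫ b)).bind fun Z' f' ⟨W', c', hW', k', hk'⟩ ↦
        ⟨_, (hcov Z'), fun Z'' f'' hZ'' ↦ ?_⟩, fun _ _ h ↦ h⟩
    refine ⟨hZ'', ⟨W, c, hW, f'' ≫ f' ≫ k, ?_⟩, ⟨W', c', hW', f'' ≫ k', ?_⟩⟩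
    · simp [hk]
    · simp [← hk'])
  refine isQuasiCompact_of_jointlyEpi hT (jointlyEpi_pullback_left hT hepi (equalizer.ι a b)) ?_
  intro i
  obtain ⟨hZ, ⟨W, c, hW, k, hk⟩, ⟨W', c', hW', k', hk'⟩⟩ := hg i
  -- On one piece, `M` consists of the pairs (z, w') with a z = c' w'; the two maps to `W'` are x =
  -- k' z and y = w'. The locus x = y is where a and b agree, and it is quasi-compact because it is
  -- a base change of the diagonal of `W'`.
  let N := pullback c c'
  have hN : IsQuasiCompact N := hY.2 c c' (hG' W hW).1.1 (hG' W' hW').1.1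
  let M := pullback k (pullback.fst c c')
  have hM : IsQuasiCompact M := (hG' W hW).1.2 _ _ (hG' _ hZ).1.1 hN
  let x : M ⟶ W' := pullback.fst _ _ ≫ k'
  let y : M ⟶ W' := pullback.snd _ _ ≫ pullback.snd _ _
  let m : M ⟶ pullback (terminal.from W') (terminal.from W') :=
    pullback.lift x y (Subsingleton.elim _ _)
  have hP := (hG' W' hW').2 m hM
  have h₁ : pullback.fst (pullback.diagonal (terminal.from W')) m ≫ 𝟙 _ =
    pullback.snd (pullback.diagonal (terminal.from W')) m ≫ x := by
    have := pullback.condition (f := pullback.diagonal (terminal.from W')) (g := m)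
    replace this := congr($this ≫ pullback.fst _ _)
    simpa [m] using this
  have h₂ : pullback.fst (pullback.diagonal (terminal.from W')) m ≫ 𝟙 _ =
    pullback.snd (pullback.diagonal (terminal.from W')) m ≫ y := by
    have := pullback.condition (f := pullback.diagonal (terminal.from W')) (g := m)
    replace this := congr($this ≫ pullback.snd _ _)
    simpa [m] using this
  have hxy := h₁.symm.trans h₂
  have hM' : pullback.fst k (pullback.fst c c') ≫ g i ≫ a =
      pullback.snd k (pullback.fst c c') ≫ pullback.snd c c' ≫ c' := by
    rw [hk, pullback.condition_assoc, pullback.condition]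
  let e : pullback (pullback.diagonal (terminal.from W')) m ⟶
      pullback (g i) (equalizer.ι a b) :=
    pullback.lift (pullback.snd _ _ ≫ pullback.fst _ _)
      (equalizer.lift (pullback.snd _ _ ≫ pullback.fst _ _ ≫ g i) (by
        simp only [Category.assoc]
        rw [hM', hk']
        simpa [x, y] using congr($(hxy.symm) ≫ c'))) (by simp)
  let t : pullback (g i) (equalizer.ι a b) ⟶ M :=
    pullback.lift (pullback.fst _ _) (pullback.lift (pullback.fst _ _ ≫ k) (pullback.fst _ _ ≫ k')
      (by
        rw [Category.assoc, Category.assoc, ← hk, ← hk', pullback.condition_assoc,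
          pullback.condition_assoc, equalizer.condition])) (by simp)
  have ht : t ≫ x = t ≫ y := by simp [t, x, y]
  let s : pullback (g i) (equalizer.ι a b) ⟶
      pullback (pullback.diagonal (terminal.from W')) m :=
    pullback.lift (t ≫ x) t (by
      apply pullback.hom_ext
      · simp [m]
      · simpa [m] using ht)
  refine isQuasiCompact_of_retraction hT hP e s ?_
  apply pullback.hom_ext
  · simp [s, e, t]
  · rw [← cancel_mono (equalizer.ι a b)]
    simp [s, e, t, pullback.condition]

/-- In an algebraic topos, the fibre products of coherent objects over coherent objects are
coherent. -/
lemma isCoherent_pullback (hA : IsAlgebraicTopos T) {X Y Z : T} (hX : IsCoherent X)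
    (hY : IsCoherent Y) (hZ : IsCoherent Z) (f : X ⟶ Z) (g : Y ⟶ Z) :
    IsCoherent (pullback f g) := by
  refine ⟨hZ.2 f g hX.1 hY.1, fun S S' u v hS hS' ↦ ?_⟩
  -- The fibre product of S and S' over X ×_Z Y is the equalizer of the two maps from S ×_X S' to Y.
  have hQ := hX.2 (u ≫ pullback.fst f g) (v ≫ pullback.fst f g) hS hS'
  have hE := isQuasiCompact_equalizer hT hA hQ hY
    (pullback.fst _ _ ≫ u ≫ pullback.snd f g) (pullback.snd _ _ ≫ v ≫ pullback.snd f g)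
  refine isQuasiCompact_of_retraction hT hE
    (pullback.lift (equalizer.ι _ _ ≫ pullback.fst _ _) (equalizer.ι _ _ ≫ pullback.snd _ _) ?_)
    (equalizer.lift (pullback.lift (pullback.fst _ _) (pullback.snd _ _)
      (by rw [pullback.condition_assoc])) (by simp [pullback.condition_assoc])) ?_
  · apply pullback.hom_ext
    · simp only [Category.assoc]
      rw [pullback.condition]
    · simp only [Category.assoc]
      exact equalizer.condition _ _
  · apply pullback.hom_ext <;> simp

end QuasiCompact

/-! ### Transfer between a topos and its slices -/

section Slices

attribute [local simp] pullback.lift_fst pullback.lift_snd pullback.lift_fst_assoc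
  pullback.lift_snd_assoc prod.lift_fst prod.lift_snd prod.lift_fst_assoc prod.lift_snd_assoc

universe v u

variable {T : Type u} [Category.{v} T] [HasFiniteLimits T]

lemma isQuasiCompact_over {X : T} {A : Over X} (hA : IsQuasiCompact A.left) :
    IsQuasiCompact A := by
  apply isQuasiCompact_of_exists_finite
  intro R hR
  obtain ⟨n, Y, h, hh, hepi⟩ := hA.exists_finite
    (R := fun (Y : T) (h : Y ⟶ A.left) ↦ ∃ (B : Over X) (f : B ⟶ A) (_ : R f) (k : Y ⟶ B.left),
      h = k ≫ f.left) (by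
    intro Z a b hab
    -- The test object `Z` has no map to `X`; the projection X ⨯ Z ⟶ X turns morphisms to `Z` into
    -- morphisms over `X`.
    let a' : A ⟶ Over.mk (prod.fst : X ⨯ Z ⟶ X) := Over.homMk (prod.lift A.hom a)
    let b' : A ⟶ Over.mk (prod.fst : X ⨯ Z ⟶ X) := Over.homMk (prod.lift A.hom b)
    have : a' = b' := hR _ _ fun B f hf ↦ by
      ext
      dsimp [a', b']
      ext
      · simp
      · simpa using hab f.left ⟨B, f, hf, 𝟙 _, by simp⟩
    simpa [a', b'] using congr($(this).left ≫ prod.snd))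
  choose B f hf k hk using hh
  refine ⟨Fin n, inferInstance, B, f, hf, fun C a b hab ↦ ?_⟩
  ext
  refine hepi _ _ fun i ↦ ?_
  rw [hk, Category.assoc, Category.assoc, ← Over.comp_left, hab, Over.comp_left]

lemma isQuasiCompact_left {X : T} {A : Over X} (hA : IsQuasiCompact A) :
    IsQuasiCompact A.left := by
  apply isQuasiCompact_of_exists_finite
  intro R hR
  obtain ⟨n, B, f, hf, hepi⟩ := hA.exists_finite
    (R := fun (B : Over X) (f : B ⟶ A) ↦ R f.left) (by
    intro C a b hab
    ext
    refine hR _ _ fun Y r hr ↦ ?_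
    exact congr($(hab (Over.homMk r : Over.mk (r ≫ A.hom) ⟶ A) hr).left))
  refine ⟨Fin n, inferInstance, _, _, hf, fun Z a b hab ↦ ?_⟩
  let a' : A ⟶ Over.mk (prod.fst : X ⨯ Z ⟶ X) := Over.homMk (prod.lift A.hom a)
  let b' : A ⟶ Over.mk (prod.fst : X ⨯ Z ⟶ X) := Over.homMk (prod.lift A.hom b)
  have : a' = b' := hepi _ _ fun i ↦ by
    ext
    dsimp [a', b']
    ext
    · simp
    · simpa using hab i
  simpa [a', b'] using congr($(this).left ≫ prod.snd)

lemma isPullback_left {X : T} {P A B C : Over X} {p : P ⟶ A} {q : P ⟶ B} {f : A ⟶ C} {g : B ⟶ C}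
    (h : IsPullback p q f g) : IsPullback p.left q.left f.left g.left :=
  h.map (Over.forget X)

variable (hT : EpiFamiliesUniversal T)
include hT

lemma isQuasiSeparated_over {X : T} {A : Over X} (hA : IsQuasiSeparated A.left) :
    IsQuasiSeparated A := fun _ _ f g hS hS' ↦
  isQuasiCompact_over (isQuasiCompact_of_isPullback hT
    (isPullback_left (IsPullback.of_hasPullback f g))
    (hA _ _ (isQuasiCompact_left hS) (isQuasiCompact_left hS')))

lemma isQuasiSeparated_of_iso {X X' : T} (hX : IsQuasiSeparated X) (e : X' ≅ X) :
    IsQuasiSeparated X' := fun S S' f g hS hS' ↦ by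
  refine isQuasiCompact_of_isPullback hT (p := pullback.fst f g) (q := pullback.snd f g) ?_
    (hX (f ≫ e.hom) (g ≫ e.hom) hS hS')
  exact (IsPullback.of_hasPullback f g).of_iso (Iso.refl _) (Iso.refl _) (Iso.refl _) e
    (by simp) (by simp) (by simp) (by simp)

lemma isQuasiSeparatedMorphism_of_isPullback {A B P : T} {f : A ⟶ B} {p q : P ⟶ A}
    (h : IsPullback p q f f) (d : A ⟶ P) (hp : d ≫ p = 𝟙 A) (hq : d ≫ q = 𝟙 A)
    (hd : IsQuasiCompactMorphism d) : IsQuasiSeparatedMorphism f := fun S g hS ↦ by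
  have hdiag : d ≫ h.isoPullback.hom = pullback.diagonal f := by
    apply pullback.hom_ext <;> simp [hp, hq]
  refine isQuasiCompact_of_isPullback hT (p := pullback.fst _ _) (q := pullback.snd _ _) ?_
    (hd (g ≫ h.isoPullback.inv) hS)
  exact (IsPullback.of_hasPullback (pullback.diagonal f) g).of_iso (Iso.refl _) (Iso.refl _)
    (Iso.refl _) h.isoPullback.symm (by simp) (by simp) (by simp [← hdiag]) (by simp)

/-- The product of `A` with itself in the slice is its fibre product over `X`, so the two diagonals
correspond. -/
lemma isQuasiSeparatedMorphism_over {X : T} {A : Over X} (hA : IsQuasiSeparatedMorphism A.hom) :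
    IsQuasiSeparatedMorphism (terminal.from A) := fun S g hS ↦ by
  apply isQuasiCompact_over
  have hiso : IsIso (⊤_ (Over X)).hom := by
    have : (⊤_ (Over X)).hom = (terminalIsTerminal.uniqueUpToIso Over.mkIdTerminal).hom.left := by
      exact (Over.w (terminalIsTerminal.uniqueUpToIso
        (Over.mkIdTerminal (X := X))).hom).symm.trans (Category.comp_id _)
    rw [this]
    exact ((Over.forget X).mapIso (terminalIsTerminal.uniqueUpToIso
      Over.mkIdTerminal)).isIso_hom
  have h₀ : IsPullback (pullback.fst (terminal.from A) (terminal.from A)).left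
      (pullback.snd (terminal.from A) (terminal.from A)).left A.hom A.hom :=
    (isPullback_left (IsPullback.of_hasPullback (terminal.from A) (terminal.from A))).of_iso
      (Iso.refl _) (Iso.refl _) (Iso.refl _) (asIso (⊤_ (Over X)).hom)
      (by simp) (by simp) (by simp) (by simp)
  have h₁ := isPullback_left (IsPullback.of_hasPullback (pullback.diagonal (terminal.from A)) g)
  refine isQuasiCompact_of_isPullback hT (h₁.of_iso (Iso.refl _) (Iso.refl _) (Iso.refl _)
    h₀.isoPullback (f' := pullback.diagonal A.hom) (g' := g.left ≫ h₀.isoPullback.hom)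
    (fst' := (pullback.fst (pullback.diagonal (terminal.from A)) g).left)
    (snd' := (pullback.snd (pullback.diagonal (terminal.from A)) g).left)
    (by simp) (by simp) ?_ (by simp)) (hA _ (isQuasiCompact_left hS))
  apply pullback.hom_ext
  · simp [← Over.comp_left]
  · simp [← Over.comp_left]

end Slices

/-! ### A criterion for coherence by a basis of quasi-compact objects -/

section Criterion

universe v u

variable {T : Type u} [Category.{v} T] [HasFiniteLimits T]

/-- A class of objects and a class of morphisms which behave like the objects and the morphisms
of a site with fibre products and with quasi-compact objects that defines a topos. -/
structure IsCoherentBasis (B : ObjectProperty T) (good : MorphismProperty T) : Prop where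
  quasiCompact {X : T} : B X → IsQuasiCompact X
  covers {S X : T} (u : S ⟶ X) : B X →
    IsEpimorphicFamily (fun (Y : T) (a : Y ⟶ S) ↦ B Y ∧ good (a ≫ u))
  generates (S : T) : IsEpimorphicFamily (fun (Y : T) (_ : Y ⟶ S) ↦ B Y)
  pullback_mem {X Y Z : T} (f : X ⟶ Z) (g : Y ⟶ Z) : good f → good g → B (pullback f g)

namespace IsCoherentBasis

variable {B : ObjectProperty T} {good : MorphismProperty T} (h : IsCoherentBasis B good)
  (hT : EpiFamiliesUniversal T)
include h hT

/-- Cover both objects by finitely many basis members with good composites to `X`; the fibre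
products of these members are again in the basis. -/
lemma isCoherent {X : T} (hX : B X) : IsCoherent X := by
  refine ⟨h.quasiCompact hX, fun S S' f g hS hS' ↦ ?_⟩
  obtain ⟨n, Y, a, ha, hepi⟩ := hS.exists_finite (h.covers f hX)
  obtain ⟨n', Y', a', ha', hepi'⟩ := hS'.exists_finite (h.covers g hX)
  exact isQuasiCompact_pullback_of_covers hT f g hepi hepi'
    fun i j ↦ h.quasiCompact (h.pullback_mem _ _ (ha i).2 (ha' j).2)

/-- The target Y ×_X Y of the diagonal belongs to the basis and so is quasi-separated; the source is
quasi-compact. -/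
lemma isQuasiCompactMorphism_diagonal {X Y : T} (hY : B Y) (f : Y ⟶ X) (hf : good f) :
    IsQuasiCompactMorphism (pullback.diagonal f) := fun _ g hS ↦
  (h.isCoherent hT (h.pullback_mem f f hf hf)).2 _ g (h.quasiCompact hY) hS

/-- The basis members with good structure morphism to `X` are the required generators of the slice.
-/
lemma isCoherentTopos_over {X : T} (hX : B X) : IsCoherentTopos (Over X) := by
  refine ⟨⟨fun A ↦ B A.left ∧ good A.hom, ?_, fun A hA ↦ ⟨⟨?_, ?_⟩, ?_⟩⟩, ?_, ?_⟩
  · intro A C a b hab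
    ext
    refine h.covers A.hom hX _ _ fun Y y hy ↦ ?_
    exact congr($(hab (Over.mk (y ≫ A.hom)) hy (Over.homMk y)).left)
  · exact isQuasiCompact_over (h.isCoherent hT hA.1).1
  · exact isQuasiSeparated_over hT (h.isCoherent hT hA.1).2
  · exact isQuasiSeparatedMorphism_over hT (h.isQuasiCompactMorphism_diagonal hT hA.1 _ hA.2)
  · refine isQuasiCompact_over (isQuasiCompact_of_iso hT (h.isCoherent hT hX).1
      ((Over.forget X).mapIso (Over.mkIdTerminal.uniqueUpToIso terminalIsTerminal)))
  · exact isQuasiSeparated_over hT (isQuasiSeparated_of_iso hT (h.isCoherent hT hX).2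
      ((Over.forget X).mapIso (terminalIsTerminal.uniqueUpToIso Over.mkIdTerminal)))

lemma isLocallyCoherentTopos : IsLocallyCoherentTopos T :=
  ⟨_, h.generates _, fun _ _ hX ↦ h.isCoherentTopos_over hT hX⟩

lemma isCoherentTopos {X : T} (hX : B X) (ht : IsTerminal X) : IsCoherentTopos T := by
  refine ⟨⟨fun Y ↦ B Y ∧ good (ht.from Y), ?_, fun A hA ↦ ⟨h.isCoherent hT hA.1, ?_⟩⟩, ?_, ?_⟩
  · intro A C a b hab
    refine h.covers (ht.from A) hX _ _ fun Y y hy ↦ hab Y ⟨hy.1, ?_⟩ y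
    rw [ht.hom_ext (ht.from Y) (y ≫ ht.from A)]
    exact hy.2
  · refine isQuasiSeparatedMorphism_of_isPullback hT (f := terminal.from A)
      (p := pullback.fst (ht.from A) (ht.from A)) (q := pullback.snd (ht.from A) (ht.from A))
      ?_ (pullback.diagonal (ht.from A)) (by simp) (by simp)
      (h.isQuasiCompactMorphism_diagonal hT hA.1 _ hA.2)
    exact (IsPullback.of_hasPullback (ht.from A) (ht.from A)).of_iso (Iso.refl _) (Iso.refl _)
      (Iso.refl _) (ht.uniqueUpToIso terminalIsTerminal) (by simp) (by simp)
      (Subsingleton.elim _ _) (Subsingleton.elim _ _)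
  · exact isQuasiCompact_of_iso hT (h.isCoherent hT hX).1 (ht.uniqueUpToIso terminalIsTerminal)
  · exact isQuasiSeparated_of_iso hT (h.isCoherent hT hX).2
      (terminalIsTerminal.uniqueUpToIso ht)

end IsCoherentBasis

end Criterion

/-! ### Sheafification on a site with a small generating family -/

section LocallyBijective

universe u

variable {C : Type u} [Category.{w} C] [HasPullbacks C] {J : GrothendieckTopology C}

/-- The statement holds on a small generating subcategory and is transported along the equivalence
of sheaf categories. It makes the unit of sheafification locally injective and locally surjective.
-/
lemma IsUSite.wEqualsLocallyBijective (hJ : IsUSite J) : J.WEqualsLocallyBijective (Type w) := by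
  have := hJ.hasSheafify
  obtain ⟨G, _, _⟩ := hJ
  have := isEquivalence_restriction J G
  have : Small.{w} G.FullSubcategory := by
    let e : G.FullSubcategory ≃ Subtype G :=
      ⟨fun X ↦ ⟨X.obj, X.property⟩, fun X ↦ ⟨X.1, X.2⟩, fun _ ↦ rfl, fun _ ↦ rfl⟩
    have h : Small.{w} (Subtype G) := ‹ObjectProperty.Small.{w} G›
    exact (small_congr e).2 h
  have : EssentiallySmall.{w} G.FullSubcategory := inferInstance
  have : (G.ι.restrictedTopology J).WEqualsLocallyBijective (Type w) :=
    GrothendieckTopology.WEqualsLocallyBijective.ofEssentiallySmall.{w} _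
  exact GrothendieckTopology.WEqualsLocallyBijective.transport J (G.ι.restrictedTopology J) G.ι
    (Functor.IsDenseSubsite.coverPreserving _ _ _)

lemma IsUSite.loc_of_toSheafify_eq [HasSheafify J (Type w)] (hJ : IsUSite J)
    {P : Cᵒᵖ ⥤ Type w} {U : C} {x y : P.obj (Opposite.op U)}
    (h : (toSheafify J P).app _ x = (toSheafify J P).app _ y) :
    Loc J (fun _ t ↦ P.map t.op x = P.map t.op y) := by
  have := hJ.wEqualsLocallyBijective
  exact ⟨Presheaf.equalizerSieve (F := P) (X := Opposite.op U) x y,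
    Presheaf.equalizerSieve_mem J (toSheafify J P) x y h, fun _ _ h ↦ h⟩

lemma IsUSite.loc_toSheafify [HasSheafify J (Type w)] (hJ : IsUSite J) {P : Cᵒᵖ ⥤ Type w} {U : C}
    (s : Sec ((presheafToSheaf J _).obj P) U) :
    Loc J (fun V t ↦ ∃ x : P.obj (Opposite.op V),
      res t s = (toSheafify J P).app (Opposite.op V) x) := by
  have := hJ.wEqualsLocallyBijective
  exact ⟨_, Presheaf.imageSieve_mem J (toSheafify J P) s, fun V t ⟨x, hx⟩ ↦ ⟨x, hx.symm⟩⟩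

end LocallyBijective

/-! ### Inverse images of sheaves by germs, and their exactness -/

section Pullback

universe u u'

variable {C : Type u} [Category.{w} C] {D : Type u'} [Category.{w} D]
  {J : GrothendieckTopology C} {K : GrothendieckTopology D} (F : C ⥤ D) [F.IsContinuous J K]
  [(F.sheafPushforwardContinuous (Type w) J K).IsRightAdjoint]

/-- The section of the inverse image of a sheaf defined by a section of the sheaf. -/
noncomputable def eta {X : Sheaf J (Type w)} {V : C} (x : Sec X V) :
    Sec ((F.sheafPullback (Type w) J K).obj X) (F.obj V) :=
  ev ((F.sheafAdjunctionContinuous (Type w) J K).unit.app X) x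

/-- The morphism from the inverse image of a sheaf which is adjoint to a morphism to a direct
image. -/
noncomputable def transpose {X : Sheaf J (Type w)} {Y : Sheaf K (Type w)}
    (φ : X ⟶ (F.sheafPushforwardContinuous (Type w) J K).obj Y) :
    (F.sheafPullback (Type w) J K).obj X ⟶ Y :=
  ((F.sheafAdjunctionContinuous (Type w) J K).homEquiv _ _).symm φ

variable {F} {X X' : Sheaf J (Type w)} {Y : Sheaf K (Type w)}

@[simp]
lemma ev_transpose_eta (φ : X ⟶ (F.sheafPushforwardContinuous (Type w) J K).obj Y) {V : C}
    (x : Sec X V) : ev (transpose F φ) (eta F x) = (ev φ x : Sec _ V) := by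
  have h := ((F.sheafAdjunctionContinuous (Type w) J K).homEquiv _ _).apply_symm_apply φ
  rw [Adjunction.homEquiv_unit] at h
  exact congr(ev $h x)

lemma sheafPullback_hom_ext {φ ψ : (F.sheafPullback (Type w) J K).obj X ⟶ Y}
    (h : ∀ (V : C) (x : Sec X V), ev φ (eta F x) = ev ψ (eta F x)) : φ = ψ := by
  apply ((F.sheafAdjunctionContinuous (Type w) J K).homEquiv _ _).injective
  apply sheaf_hom_ext
  intro V x
  rw [Adjunction.homEquiv_unit, Adjunction.homEquiv_unit]
  exact h V x

variable (F K) in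
lemma eta_res {V W : C} (f : W ⟶ V) (x : Sec X V) :
    eta F (K := K) (res f x) = res (F.map f) (eta F x) :=
  ev_res ((F.sheafAdjunctionContinuous (Type w) J K).unit.app X) f x

@[simp]
lemma ev_map_eta (φ : X ⟶ X') {V : C} (x : Sec X V) :
    ev ((F.sheafPullback (Type w) J K).map φ) (eta F x) = eta F (ev φ x) :=
  congr(ev $(((F.sheafAdjunctionContinuous (Type w) J K).unit.naturality φ).symm) x)

/-- The sections of an inverse image locally come from sections of the sheaf. -/
lemma loc_sheafPullback {U : D} (s : Sec ((F.sheafPullback (Type w) J K).obj X) U) :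
    Loc K (fun W t ↦ ∃ (V : C) (v : W ⟶ F.obj V) (x : Sec X V), res t s = res v (eta F x)) := by
  let N : ClosedSub ((F.sheafPullback (Type w) J K).obj X) := ClosedSub.ofLoc
    (fun W s ↦ ∃ (V : C) (v : W ⟶ F.obj V) (x : Sec X V), s = res v (eta F x))
  have hN (V : C) (x : Sec X V) : N.mem (eta F x) := ClosedSub.mem_ofLoc_of (by
    rintro W W' f _ ⟨V, v, x, rfl⟩
    exact ⟨V, f ≫ v, x, by simp⟩) ⟨V, 𝟙 _, x, by simp⟩
  let φ : X ⟶ (F.sheafPushforwardContinuous (Type w) J K).obj N.sheaf :=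
    homOfSec (fun V x ↦ (⟨eta F x, hN V x⟩ : Sec N.sheaf (F.obj V))) (fun V W g x ↦
      Subtype.ext (eta_res K F g x))
  exact N.mem_of_section (transpose F φ) (sheafPullback_hom_ext fun V x ↦ by
    rw [ev_comp, ev_transpose_eta]
    rfl) s

/-- Two sections of a sheaf on the images of which we are given morphisms from the same object
agree locally. -/
def LocAgree (F : C ⥤ D) (K : GrothendieckTopology D) {U : D} {V V' : C} (v : U ⟶ F.obj V)
    (v' : U ⟶ F.obj V') (x : Sec X V) (x' : Sec X V') : Prop :=
  Loc K (fun W t ↦ ∃ (V'' : C) (b : V'' ⟶ V) (b' : V'' ⟶ V') (m : W ⟶ F.obj V''),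
    res b x = res b' x' ∧ m ≫ F.map b = t ≫ v ∧ m ≫ F.map b' = t ≫ v')

namespace LocAgree

variable {U U' : D} {V V' V'' : C} {v : U ⟶ F.obj V} {v' : U ⟶ F.obj V'} {v'' : U ⟶ F.obj V''}
  {x : Sec X V} {x' : Sec X V'} {x'' : Sec X V''}

omit [F.IsContinuous J K] [(F.sheafPushforwardContinuous (Type w) J K).IsRightAdjoint]

variable (K) in
lemma refl (v : U ⟶ F.obj V) (x : Sec X V) : LocAgree F K v v x x :=
  Loc.of_forall fun _ t ↦ ⟨V, 𝟙 V, 𝟙 V, t ≫ v, by simp⟩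

lemma symm (h : LocAgree F K v v' x x') : LocAgree F K v' v x' x :=
  h.mono fun _ _ ⟨V'', b, b', m, h₁, h₂, h₃⟩ ↦ ⟨V'', b', b, m, h₁.symm, h₃, h₂⟩

/-- The two witnesses are combined in their fibre product over `V'`, which `F` preserves. -/
lemma trans [HasPullbacks C] [PreservesLimitsOfShape WalkingCospan F]
    (h : LocAgree F K v v' x x') (h' : LocAgree F K v' v'' x' x'') :
    LocAgree F K v v'' x x'' := by
  refine (Loc.and h h').mono ?_
  rintro W t ⟨⟨V₁, b₁, b₁', m₁, h₁, e₁, e₁'⟩, ⟨V₂, b₂, b₂', m₂, h₂, e₂, e₂'⟩⟩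
  have hP := (IsPullback.of_hasPullback b₁' b₂).map F
  refine ⟨pullback b₁' b₂, pullback.fst _ _ ≫ b₁, pullback.snd _ _ ≫ b₂',
    hP.lift m₁ m₂ (by rw [e₁', e₂]), ?_, ?_, ?_⟩
  · rw [← res_res, h₁, ← res_res, ← h₂, res_res, res_res, pullback.condition]
  · rw [Functor.map_comp, hP.lift_fst_assoc, e₁]
  · rw [Functor.map_comp, hP.lift_snd_assoc, e₂']

lemma pullback (h : LocAgree F K v v' x x') (g : U' ⟶ U) :
    LocAgree F K (g ≫ v) (g ≫ v') x x' := by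
  refine (Loc.pullback h g).mono ?_
  rintro W t ⟨V₁, b₁, b₁', m₁, h₁, e₁, e₁'⟩
  exact ⟨V₁, b₁, b₁', m₁, h₁, by simpa using e₁, by simpa using e₁'⟩

lemma of_loc (h : Loc K (fun _ t ↦ LocAgree F K (t ≫ v) (t ≫ v') x x')) :
    LocAgree F K v v' x x' := by
  refine Loc.bind h fun W t ht ↦ ht.mono ?_
  rintro W' t' ⟨V₁, b₁, b₁', m₁, h₁, e₁, e₁'⟩
  exact ⟨V₁, b₁, b₁', m₁, h₁, by simpa using e₁, by simpa using e₁'⟩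

lemma res_right (v : U ⟶ F.obj V) (b : V ⟶ V') (x : Sec X V') :
    LocAgree F K v (v ≫ F.map b) (res b x) x :=
  Loc.of_forall fun _ t ↦ ⟨V, 𝟙 V, b, t ≫ v, by simp⟩

end LocAgree

section Germs

variable [HasPullbacks C] [PreservesLimitsOfShape WalkingCospan F]

omit [F.IsContinuous J K] [(F.sheafPushforwardContinuous (Type w) J K).IsRightAdjoint]

variable (F K X) in
/-- Sections of a sheaf `X` on objects to the images of which `U` maps, up to local agreement. -/
def germSetoid (U : D) : Setoid (Σ V : C, (U ⟶ F.obj V) × Sec X V) where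
  r a a' := LocAgree F K a.2.1 a'.2.1 a.2.2 a'.2.2
  iseqv := ⟨fun _ ↦ LocAgree.refl K _ _, fun h ↦ h.symm, fun h h' ↦ h.trans h'⟩

/-- The objects `V` range over a possibly large class, but a germ is determined by its traces on the
small generating families of the two sites. -/
lemma small_germs (hJ : IsUSite J) (hK : IsUSite K) (hF : CoverPreserving J K F) (U : D) :
    Small.{w} (Quotient (germSetoid K F X U)) := by
  obtain ⟨G, hG, _⟩ := hJ
  obtain ⟨G', hG', _⟩ := hK
  have : Small.{w} (Subtype G) := hG
  have : Small.{w} (Subtype G') := hG'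
  let A := Σ (g : Subtype G') (g' : Subtype G), (g.1 ⟶ U) × (g.1 ⟶ F.obj g'.1) × Sec X g'.1
  -- `Φ a` records all restrictions of the germ `a` along generators g ⟶ U that factor through F g'
  -- for a generator g'. Such maps cover `U`, so `Φ a` determines `a` up to local agreement.
  let Φ (a : Σ V : C, (U ⟶ F.obj V) × Sec X V) : Set A := { y |
    ∃ b : y.2.1.1 ⟶ a.1, y.2.2.2.1 ≫ F.map b = y.2.2.1 ≫ a.2.1 ∧ y.2.2.2.2 = res b a.2.2 }
  have hΦ (a a' : Σ V : C, (U ⟶ F.obj V) × Sec X V) (h : Φ a = Φ a') :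
      LocAgree F K a.2.1 a'.2.1 a.2.2 a'.2.2 := by
    have h₁ : Loc K (fun W t ↦ ∃ (g' : Subtype G) (b : g'.1 ⟶ a.1) (m : W ⟶ F.obj g'.1),
        m ≫ F.map b = t ≫ a.2.1) := by
      refine ⟨_, K.pullback_stable a.2.1
        (hF.cover_preserve (G.ι.is_cover_of_isCoverDense J a.1)), ?_⟩
      rintro W t ⟨Z, g, m, ⟨⟨Z', l, b, rfl⟩⟩, e⟩
      exact ⟨⟨Z'.obj, Z'.property⟩, b, m ≫ F.map l, by simp [e]⟩
    have h₂ : Loc K (fun (W : D) (_ : W ⟶ U) ↦ ∃ (g : Subtype G'), Nonempty (W ⟶ g.1)) := by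
      refine Loc.of_sieve (G'.ι.is_cover_of_isCoverDense K U) ?_
      rintro W t ⟨⟨Z, l, m, rfl⟩⟩
      exact ⟨⟨Z.obj, Z.property⟩, ⟨l⟩⟩
    refine Loc.bind h₁ fun W t ⟨g', b, m, e⟩ ↦ ?_
    refine Loc.of_sieve (G'.ι.is_cover_of_isCoverDense K W) ?_
    rintro W' t' ⟨⟨Z, l, k, rfl⟩⟩
    have hy : (⟨⟨Z.obj, Z.property⟩, g', k ≫ t, k ≫ m, res b a.2.2⟩ : A) ∈ Φ a :=
      ⟨b, by simp [e], rfl⟩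
    rw [h] at hy
    obtain ⟨b', e', hx⟩ := hy
    exact ⟨g'.1, b, b', l ≫ k ≫ m, hx, by simp [e], by simpa using congr(l ≫ $e')⟩
  exact small_of_injective (f := fun q : Quotient (germSetoid K F X U) ↦ Φ q.out) fun q q' h ↦ by
    rw [← q.out_eq, ← q'.out_eq]
    exact Quotient.sound (hΦ _ _ h)

variable (F K X) in
/-- The presheaf of germs, with values in small sets. -/
noncomputable def germs (hs : ∀ U : D, Small.{w} (Quotient (germSetoid K F X U))) :
    Dᵒᵖ ⥤ Type w where
  obj U := @Shrink.{w} (Quotient (germSetoid K F X U.unop)) (hs _)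
  map {U U'} g := ↾fun q ↦ @equivShrink _ (hs _) (Quotient.map
    (fun (a : Σ V : C, (U.unop ⟶ F.obj V) × Sec X V) ↦ ⟨a.1, g.unop ≫ a.2.1, a.2.2⟩)
    (fun _ _ h ↦ LocAgree.pullback h g.unop)
    ((@equivShrink _ (hs _)).symm q))
  map_id U := by
    ext q
    obtain ⟨q, rfl⟩ := (@equivShrink _ (hs _)).surjective q
    induction q using Quotient.inductionOn
    simp
  map_comp f g := by
    ext q
    obtain ⟨q, rfl⟩ := (@equivShrink _ (hs _)).surjective q
    induction q using Quotient.inductionOn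
    simp
    rfl

end Germs

variable [HasPullbacks C] [HasPullbacks D] [PreservesLimitsOfShape WalkingCospan F]

/-- Two sections of a sheaf which define the same section of the inverse image agree locally. -/
lemma locAgree_of_res_eta_eq (hJ : IsUSite J) (hK : IsUSite K) {U : D} {V V' : C}
    {v : U ⟶ F.obj V} {v' : U ⟶ F.obj V'} {x : Sec X V} {x' : Sec X V'}
    (h : res v (eta F (K := K) x) = res v' (eta F x')) : LocAgree F K v v' x x' := by
  have hs := small_germs (X := X) hJ hK (CoverPreserving.of_isContinuous F J K)
  have := hK.hasSheafify
  -- The sheafified presheaf of germs receives a map from the inverse image which sends a section to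
  -- its germ, and sheafification identifies only germs that are locally equal.
  let M := (presheafToSheaf K _).obj (germs K F X hs)
  let τ : germs K F X hs ⟶ M.obj := toSheafify K _
  let γ {U : D} (V : C) (v : U ⟶ F.obj V) (x : Sec X V) : (germs K F X hs).obj (Opposite.op U) :=
    @equivShrink _ (hs _) (Quotient.mk _ ⟨V, v, x⟩)
  have hγ {U U' : D} (V : C) (v : U ⟶ F.obj V) (x : Sec X V) (g : U' ⟶ U) :
      (germs K F X hs).map g.op (γ V v x) = γ V (g ≫ v) x := by
    change equivShrink _ (Quotient.map _ _ ((equivShrink _).symm (equivShrink _ _))) = _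
    rw [Equiv.symm_apply_apply]
    rfl
  have hγ' {U : D} {V V' : C} {v : U ⟶ F.obj V} {v' : U ⟶ F.obj V'} {x : Sec X V}
      {x' : Sec X V'} : γ V v x = γ V' v' x' ↔ LocAgree F K v v' x x' := by
    exact (Equiv.apply_eq_iff_eq _).trans Quotient.eq
  have hτγ {U U' : D} (V : C) (v : U ⟶ F.obj V) (x : Sec X V) (g : U' ⟶ U) :
      res (F := M) g (τ.app _ (γ V v x)) = τ.app _ (γ V (g ≫ v) x) := by
    rw [← hγ]
    exact (ConcreteCategory.congr_hom (τ.naturality g.op) (γ V v x)).symm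
  let φ : X ⟶ (F.sheafPushforwardContinuous (Type w) J K).obj M :=
    homOfSec (fun V x ↦ τ.app _ (γ V (𝟙 _) x)) (fun V W g x ↦ by
      refine Eq.trans (congrArg (τ.app (Opposite.op (F.obj W)))
        ((hγ'.2 (LocAgree.res_right (𝟙 _) g x)).trans ?_)) (hτγ V (𝟙 _) x (F.map g)).symm
      rw [Category.comp_id, Category.id_comp])
  have hφ {U : D} (V : C) (v : U ⟶ F.obj V) (x : Sec X V) :
      ev (transpose F φ) (res v (eta F x)) = τ.app _ (γ V v x) := by
    rw [ev_res, ev_transpose_eta]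
    refine (hτγ V (𝟙 _) x v).trans ?_
    rw [Category.comp_id]
  have h' := congr(ev (transpose F φ) $h)
  rw [hφ, hφ] at h'
  exact LocAgree.of_loc ((hK.loc_of_toSheafify_eq h').mono fun W t ht ↦
    hγ'.1 (by simpa [hγ] using ht))

/-- The inverse image functor preserves fibre products. -/
lemma isPullback_sheafPullback_map (hJ : IsUSite J) (hK : IsUSite K) [HasEqualizers C]
    [PreservesLimitsOfShape WalkingParallelPair F] {P A B Z : Sheaf J (Type w)}
    {p : P ⟶ A} {q : P ⟶ B} {f : A ⟶ Z} {g : B ⟶ Z} (h : IsPullback p q f g) :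
    IsPullback ((F.sheafPullback (Type w) J K).map p) ((F.sheafPullback (Type w) J K).map q)
      ((F.sheafPullback (Type w) J K).map f) ((F.sheafPullback (Type w) J K).map g) := by
  have := hJ.hasSheafify
  refine isPullback_of_sections ?_ (fun U s s' hp hq ↦ ?_) (fun U x y hxy ↦ ?_)
  · rw [← Functor.map_comp, h.w, Functor.map_comp]
  · refine Loc.bind ((loc_sheafPullback s).and (loc_sheafPullback s')) ?_
    rintro W t ⟨⟨V, v, z, hz⟩, ⟨V', v', z', hz'⟩⟩
    have h₁ : LocAgree F K v v' (ev p z) (ev p z') := locAgree_of_res_eta_eq hJ hK (by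
      rw [← ev_map_eta, ← ev_map_eta, ← ev_res, ← ev_res, ← hz, ← hz', ev_res, ev_res, hp])
    have h₂ : LocAgree F K v v' (ev q z) (ev q z') := locAgree_of_res_eta_eq hJ hK (by
      rw [← ev_map_eta, ← ev_map_eta, ← ev_res, ← ev_res, ← hz, ← hz', ev_res, ev_res, hq])
    refine (Loc.and h₁ h₂).mono ?_
    rintro W' t' ⟨⟨V₁, b₁, b₁', m₁, h₁, e₁, e₁'⟩, ⟨V₂, b₂, b₂', m₂, h₂, e₂, e₂'⟩⟩
    -- The witnesses for the two projections may differ. Over the fibre product on `V`, the two maps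
    -- to `V'` are made equal by an equalizer; `F` preserves both limits.
    have hP := (IsPullback.of_hasPullback b₁ b₂).map F
    let m₃ := hP.lift m₁ m₂ (by rw [e₁, e₂])
    let c := pullback.fst b₁ b₂ ≫ b₁'
    let d := pullback.snd b₁ b₂ ≫ b₂'
    have hm₃ : m₃ ≫ F.map c = m₃ ≫ F.map d := by
      simp only [m₃, c, d, Functor.map_comp]
      rw [hP.lift_fst_assoc, hP.lift_snd_assoc, e₁', e₂']
    let hE := isLimitForkMapOfIsLimit F (equalizer.condition c d) (equalizerIsEqualizer c d)
    obtain ⟨m₄, hm₄⟩ := Fork.IsLimit.lift' hE m₃ hm₃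
    change m₄ ≫ F.map (equalizer.ι c d) = m₃ at hm₄
    let a := equalizer.ι c d ≫ pullback.fst b₁ b₂ ≫ b₁
    let a' := equalizer.ι c d ≫ pullback.fst b₁ b₂ ≫ b₁'
    have ha : m₄ ≫ F.map a = t' ≫ v := by
      simp only [a, Functor.map_comp]
      rw [reassoc_of% hm₄, hP.lift_fst_assoc, e₁]
    have ha' : m₄ ≫ F.map a' = t' ≫ v' := by
      simp only [a', Functor.map_comp]
      rw [reassoc_of% hm₄, hP.lift_fst_assoc, e₁']
    have hzz : res a z = res a' z' := by
      apply sec_ext_of_isPullback h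
      · simp only [a, a', ev_res]
        rw [← res_res, ← res_res, h₁]
        simp
      · have : a = equalizer.ι c d ≫ pullback.snd b₁ b₂ ≫ b₂ := by simp [a, pullback.condition]
        rw [this]
        have : a' = equalizer.ι c d ≫ pullback.snd b₁ b₂ ≫ b₂' := equalizer.condition c d
        rw [this]
        simp only [ev_res]
        simpa using congr(res (equalizer.ι c d ≫ pullback.snd b₁ b₂) $h₂)
    rw [← res_res, ← res_res, hz, hz', res_res, res_res, ← ha, ← ha', ← res_res, ← res_res,
      ← eta_res, ← eta_res, hzz]
  · refine Loc.bind ((loc_sheafPullback x).and (loc_sheafPullback y)) ?_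
    rintro W t ⟨⟨V, v, z, hz⟩, ⟨V', v', z', hz'⟩⟩
    have h₁ : LocAgree F K v v' (ev f z) (ev g z') := locAgree_of_res_eta_eq hJ hK (by
      rw [← ev_map_eta, ← ev_map_eta, ← ev_res, ← ev_res, ← hz, ← hz', ev_res, ev_res, hxy])
    refine Loc.mono h₁ ?_
    rintro W' t' ⟨V₁, b₁, b₁', m₁, h₁, e₁, e₁'⟩
    obtain ⟨c, hc, hc'⟩ := exists_sec_of_isPullback h (res b₁ z) (res b₁' z') (by simpa using h₁)
    refine ⟨res m₁ (eta F c), ?_, ?_⟩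
    · rw [ev_res, ev_map_eta, hc, eta_res, res_res, e₁, ← res_res, ← hz, res_res]
    · rw [ev_res, ev_map_eta, hc', eta_res, res_res, e₁', ← res_res, ← hz', res_res]

end Pullback

/-! ### Morphisms of a cloven fibred category and their bases -/

section FibredGeometry

variable {I : Type u₁} [Category.{w} I] {E : Type u₂} [Category.{w} E] {π : E ⥤ I}

/-- The inclusion of a fibre. -/
abbrev incl (k : I) : π.Fiber k ⥤ E := Functor.Fiber.fiberInclusion

/-- An object as an object of its fibre. -/
def self (π : E ⥤ I) (U : E) : π.Fiber (π.obj U) := Functor.Fiber.mk rfl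

lemma obj_incl {k : I} (V : π.Fiber k) : π.obj ((incl k).obj V) = k := V.2

/-- The morphism of the base below a morphism whose target belongs to a fibre. -/
def base {U : E} {k : I} (V : π.Fiber k) (v : U ⟶ (incl k).obj V) : π.obj U ⟶ k :=
  π.map v ≫ eqToHom (obj_incl V)

lemma isHomLift_base {U : E} {k : I} (V : π.Fiber k) (v : U ⟶ (incl k).obj V) :
    π.IsHomLift (base V v) v :=
  IsHomLift.of_fac π _ v rfl (obj_incl V) (by simp [base])

lemma base_eq {U : E} {k : I} {V : π.Fiber k} {v : U ⟶ (incl k).obj V} (f : π.obj U ⟶ k)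
    (h : π.IsHomLift f v) : base V v = f := by
  have := IsHomLift.fac π f v
  simpa [base] using this.symm

lemma base_comp {U U' : E} {k : I} (V : π.Fiber k) (v : U ⟶ (incl k).obj V) (g : U' ⟶ U) :
    base V (g ≫ v) = π.map g ≫ base V v := by simp [base]

@[simp]
lemma base_comp_map {U : E} {k : I} {V V' : π.Fiber k} (v : U ⟶ (incl k).obj V) (b : V ⟶ V') :
    base V' (v ≫ (incl k).map b) = base V v := by
  have := isHomLift_base V v
  exact base_eq _ inferInstance

/-- The identity, as a morphism to an object of a fibre. -/
def toSelf (π : E ⥤ I) (U : E) : U ⟶ (incl _).obj (self π U) := 𝟙 U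

instance (U : E) : IsIso (toSelf π U) := inferInstanceAs (IsIso (𝟙 U))

@[simp]
lemma base_toSelf (U : E) : base (self π U) (toSelf π U) = 𝟙 _ :=
  base_eq _ (inferInstanceAs (π.IsHomLift _ (𝟙 U)))

/-- The cartesian morphisms of a cleavage. -/
def Cleavage.cart (c : Cleavage π) {m k : I} (f : m ⟶ k) (V : π.Fiber k) :
    (incl m).obj ((c.pullbackFunctor f).obj V) ⟶ (incl k).obj V := c.lift f V

instance (c : Cleavage π) {m k : I} (f : m ⟶ k) (V : π.Fiber k) :
    π.IsCartesian f (c.cart f V) := c.isCartesian f V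

@[simp]
lemma base_comp_cart (c : Cleavage π) {U : E} {k m : I} (f : m ⟶ k) (V : π.Fiber k)
    (v : U ⟶ (incl m).obj ((c.pullbackFunctor f).obj V)) :
    base V (v ≫ c.cart f V) = base _ v ≫ f := by
  have := isHomLift_base _ v
  exact base_eq _ inferInstance

@[simp]
lemma map_pullbackFunctor_cart (c : Cleavage π) {k m : I} (f : m ⟶ k) {V W : π.Fiber k}
    (b : V ⟶ W) :
    (incl m).map ((c.pullbackFunctor f).map b) ≫ c.cart f W = c.cart f V ≫ (incl k).map b :=
  Functor.IsCartesian.fac π f (c.lift f W) (c.lift f V ≫ b.1)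

@[simp]
lemma map_pullbackFunctor_cart_assoc (c : Cleavage π) {k m : I} (f : m ⟶ k) {V W : π.Fiber k}
    (b : V ⟶ W) {U : E} (u : (incl k).obj W ⟶ U) :
    (incl m).map ((c.pullbackFunctor f).map b) ≫ c.cart f W ≫ u =
      c.cart f V ≫ (incl k).map b ≫ u := by
  rw [← Category.assoc, map_pullbackFunctor_cart, Category.assoc]

/-- Two morphisms to an inverse image agree if they agree after composition with the cartesian
morphism and have the same image in the base. -/
lemma cart_hom_ext [π.IsFibered] (c : Cleavage π) {U : E} {k m : I} {f : m ⟶ k} {V : π.Fiber k}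
    {v v' : U ⟶ (incl m).obj ((c.pullbackFunctor f).obj V)} (hb : base _ v = base _ v')
    (h : v ≫ c.cart f V = v' ≫ c.cart f V) : v = v' := by
  have h₁ := isHomLift_base _ v
  have h₂ := isHomLift_base _ v'
  rw [← hb] at h₂
  exact Functor.IsStronglyCartesian.ext π f (c.cart f V) (base _ v) h

lemma exists_lift [π.IsFibered] (c : Cleavage π) {U : E} {k m : I} {f : m ⟶ k} {V : π.Fiber k}
    (v : U ⟶ (incl k).obj V) (g : π.obj U ⟶ m) (h : base V v = g ≫ f) :
    ∃ v' : U ⟶ (incl m).obj ((c.pullbackFunctor f).obj V),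
      base _ v' = g ∧ v' ≫ c.cart f V = v := by
  have := isHomLift_base _ v
  exact ⟨Functor.IsStronglyCartesian.map π f (c.cart f V) h v, base_eq _ inferInstance,
    Functor.IsStronglyCartesian.fac _ _ _ _ _⟩

lemma exists_map_eq {k : I} {V W : π.Fiber k} (v : (incl k).obj V ⟶ (incl k).obj W)
    (h : base W v = eqToHom (obj_incl V)) : ∃ v' : V ⟶ W, (incl k).map v' = v := by
  have := isHomLift_base _ v
  rw [h] at this
  obtain ⟨V, rfl⟩ := V
  exact ⟨⟨v, this⟩, rfl⟩

lemma base_map {k : I} {V W : π.Fiber k} (v : V ⟶ W) :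
    base W ((incl k).map v) = eqToHom (obj_incl V) := by
  have := base_comp_map (𝟙 ((incl k).obj V)) v
  rw [Category.id_comp] at this
  rw [this]
  simp [base]

/-- A morphism over an identity as a morphism of a fibre. -/
lemma exists_fibre_hom {U : E} {W : π.Fiber (π.obj U)} (v : U ⟶ (incl _).obj W)
    (h : base W v = 𝟙 _) : ∃ v' : self π U ⟶ W, toSelf π U ≫ (incl _).map v' = v := by
  have := isHomLift_base _ v
  rw [h] at this
  exact ⟨⟨v, this⟩, Category.id_comp v⟩

@[simp]
lemma base_toSelf_map {U : E} {W : π.Fiber (π.obj U)} (v : self π U ⟶ W) :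
    base W (toSelf π U ≫ (incl _).map v) = 𝟙 _ := by
  rw [base_comp_map, base_toSelf]

lemma fibre_hom_ext {U : E} {W : π.Fiber (π.obj U)} {v v' : self π U ⟶ W}
    (h : toSelf π U ≫ (incl _).map v = toSelf π U ≫ (incl _).map v') : v = v' :=
  (incl _).map_injective ((cancel_epi _).1 h)

end FibredGeometry

/-! ### Finite connected limits in the total category -/

namespace FibredSite

variable {I : Type u₁} [Category.{w} I] {E : Type u₂} [Category.{w} E] {π : E ⥤ I}
  [π.IsFibered] [∀ i, HasFiniteLimits (π.Fiber i)] (S : FibredSite π)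

include S in
/-- The inclusions of the fibres preserve finite connected limits. -/
lemma preservesLimitsOfShape_incl (k : I) (N : Type) [SmallCategory N] [FinCategory N]
    [IsConnected N] : PreservesLimitsOfShape N (incl k : π.Fiber k ⥤ E) where
  preservesLimit {F} := ⟨fun {t} ht ↦ by
    have key (s : Cone (F ⋙ (incl k : π.Fiber k ⥤ E))) :
        ∃ l : s.pt ⟶ (incl k).obj t.pt, (∀ n, l ≫ (incl k).map (t.π.app n) = s.π.app n) ∧
          ∀ l' : s.pt ⟶ (incl k).obj t.pt,
            (∀ n, l' ≫ (incl k).map (t.π.app n) = s.π.app n) → l' = l := by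
      let c := S.cleavage
      let σ (n : N) : s.pt ⟶ (incl k).obj (F.obj n) := s.π.app n
      have hσ {n n' : N} (a : n ⟶ n') : σ n ≫ (incl k).map (F.map a) = σ n' := s.w a
      -- Connectedness forces all legs of the cone to lie over one morphism `f`. The cone thus
      -- becomes a cone on the inverse image of the diagram by `f`, and `f⁺` preserves the limit.
      obtain ⟨f, hf⟩ := constant_of_preserves_morphisms' (fun n ↦ base (F.obj n) (σ n))
        (fun n n' a ↦ by rw [← hσ a, base_comp_map])
      choose v hvb hv using fun n ↦ exists_lift c (f := f) (σ n) (𝟙 _) (by rw [hf]; simp)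
      choose v' hv' using fun n ↦ exists_fibre_hom (v n) (hvb n)
      have hv'' {n n' : N} (a : n ⟶ n') : v' n ≫ (c.pullbackFunctor f).map (F.map a) = v' n' := by
        apply fibre_hom_ext
        refine cart_hom_ext c (by rw [base_toSelf_map, base_toSelf_map]) ?_
        rw [Functor.map_comp, Category.assoc, Category.assoc, map_pullbackFunctor_cart,
          reassoc_of% (hv' n), hv', reassoc_of% (hv n), hσ, hv]
      let s' : Cone (F ⋙ c.pullbackFunctor f) :=
        { pt := self π s.pt
          π := { app := v', naturality n n' a := (Category.id_comp _).trans (hv'' a).symm } }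
      have hl := isLimitOfPreserves (c.pullbackFunctor f) ht
      let l : self π s.pt ⟶ (c.pullbackFunctor f).obj t.pt := hl.lift s'
      have hl' (n : N) : l ≫ (c.pullbackFunctor f).map (t.π.app n) = v' n := hl.fac s' n
      refine ⟨toSelf π s.pt ≫ (incl _).map l ≫ c.cart f t.pt, fun n ↦ ?_, fun l' hl'' ↦ ?_⟩
      · change _ = σ n
        simp only [Category.assoc]
        refine Eq.trans (congrArg (fun x ↦ toSelf π s.pt ≫ (incl _).map l ≫ x)
          (map_pullbackFunctor_cart c f (t.π.app n)).symm) ?_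
        rw [← Functor.map_comp_assoc, hl', reassoc_of% (hv' n), hv]
      · have hb : base t.pt l' = f := by
          rw [← hf (Classical.arbitrary N), ← base_comp_map l' (t.π.app (Classical.arbitrary N))]
          exact congrArg _ (hl'' _)
        obtain ⟨l₁, h₁, h₁'⟩ := exists_lift c (f := f) l' (𝟙 _) (by rw [hb]; simp)
        obtain ⟨l₂, h₂⟩ := exists_fibre_hom l₁ h₁
        have : l₂ = l := by
          refine hl.hom_ext fun n ↦ ?_
          refine Eq.trans ?_ (hl' n).symm
          apply fibre_hom_ext
          change toSelf π s.pt ≫ (incl _).map (l₂ ≫ (c.pullbackFunctor f).map (t.π.app n)) = _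
          refine cart_hom_ext c (by rw [base_toSelf_map, base_toSelf_map]) ?_
          rw [Functor.map_comp, Category.assoc, Category.assoc, hv', hv]
          refine Eq.trans (congrArg (fun x ↦ toSelf π s.pt ≫ (incl _).map l₂ ≫ x)
            (map_pullbackFunctor_cart c f (t.π.app n))) ?_
          rw [reassoc_of% h₂]
          refine Eq.trans (Category.assoc _ _ _).symm ?_
          exact (congrArg (· ≫ (incl k).map (t.π.app n)) h₁').trans (hl'' n)
        rw [← this, reassoc_of% h₂, h₁']
    exact ⟨{
      lift s := (key s).choose
      fac s n := (key s).choose_spec.1 n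
      uniq s m hm := (key s).choose_spec.2 m hm }⟩⟩

include S in
lemma preservesPullbacks_incl (k : I) :
    PreservesLimitsOfShape WalkingCospan (incl k : π.Fiber k ⥤ E) :=
  S.preservesLimitsOfShape_incl k WalkingCospan

include S in
lemma preservesEqualizers_incl (k : I) :
    PreservesLimitsOfShape WalkingParallelPair (incl k : π.Fiber k ⥤ E) :=
  S.preservesLimitsOfShape_incl k WalkingParallelPair

include S in
/-- The total category has fibre products. -/
lemma hasPullbacks [HasPullbacks I] : HasPullbacks E := by
  have key {V V' Z : E} (g : V ⟶ Z) (g' : V' ⟶ Z) :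
      ∃ (P : E) (p : P ⟶ V) (p' : P ⟶ V'), IsPullback p p' g g' := by
    let c := S.cleavage
    let q := pullback.fst (π.map g) (π.map g')
    let q' := pullback.snd (π.map g) (π.map g')
    let h := q ≫ π.map g
    have hh : h = q' ≫ π.map g' := pullback.condition
    let u := c.cart q (self π V) ≫ inv (toSelf π V) ≫ g ≫ toSelf π Z
    let u' := c.cart q' (self π V') ≫ inv (toSelf π V') ≫ g' ≫ toSelf π Z
    have hinv (X : E) : π.map (inv (toSelf π X)) = eqToHom (obj_incl _) := by
      have := base_toSelf (π := π) X
      rw [base] at this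
      rw [← cancel_epi (π.map (toSelf π X)), ← Functor.map_comp, IsIso.hom_inv_id, this,
        CategoryTheory.Functor.map_id]
    have hbase {m n : I} (f : m ⟶ n) (W : π.Fiber n) :
        π.map (c.cart f W) ≫ eqToHom (obj_incl W) = eqToHom (obj_incl _) ≫ f := by
      have := base_comp_cart c f W (𝟙 _)
      simpa [base] using this
    -- The fibre product is formed in the fibre over the fibre product of the bases, from the
    -- inverse images of `V`, `V'` and `Z`.
    obtain ⟨a, ha, ha'⟩ := exists_lift c (f := h) u (eqToHom (obj_incl _)) (by
      simp only [u, base_comp, base_toSelf, hinv, Category.comp_id]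
      rw [reassoc_of% (hbase q (self π V))])
    obtain ⟨a', hb, hb'⟩ := exists_lift c (f := h) u' (eqToHom (obj_incl _)) (by
      simp only [u', base_comp, base_toSelf, hinv, Category.comp_id]
      rw [reassoc_of% (hbase q' (self π V')), hh])
    obtain ⟨a, rfl⟩ := exists_map_eq a ha
    obtain ⟨a', rfl⟩ := exists_map_eq a' hb
    have := S.preservesPullbacks_incl (pullback (π.map g) (π.map g'))
    have hP := (IsPullback.of_hasPullback a a').map (incl _)
    let r := (incl _).map (pullback.fst a a') ≫ c.cart q (self π V)
    let r' := (incl _).map (pullback.snd a a') ≫ c.cart q' (self π V')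
    have hr : r ≫ inv (toSelf π V) ≫ g = r' ≫ inv (toSelf π V') ≫ g' := by
      rw [← cancel_mono (toSelf π Z)]
      simp only [r, r', Category.assoc]
      change _ ≫ u = _ ≫ u'
      rw [← ha', ← hb', reassoc_of% hP.w]
    refine ⟨_, r ≫ inv (toSelf π V), r' ≫ inv (toSelf π V'),
      ⟨⟨by simpa only [Category.assoc] using hr⟩,
      ⟨PullbackCone.isLimitAux' _ fun s ↦ Classical.choice ?_⟩⟩⟩
    let t : π.obj s.pt ⟶ pullback (π.map g) (π.map g') :=
      pullback.lift (π.map s.fst) (π.map s.snd)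
        (by rw [← Functor.map_comp, s.condition, Functor.map_comp])
    obtain ⟨x, hx, hx'⟩ := exists_lift c (f := q) (s.fst ≫ toSelf π V) t (by
      rw [base_comp, base_toSelf, Category.comp_id]
      exact (pullback.lift_fst _ _ _).symm)
    obtain ⟨y, hy, hy'⟩ := exists_lift c (f := q') (s.snd ≫ toSelf π V') t (by
      rw [base_comp, base_toSelf, Category.comp_id]
      exact (pullback.lift_snd _ _ _).symm)
    have hxy : x ≫ (incl _).map a = y ≫ (incl _).map a' := by
      refine cart_hom_ext c (by rw [base_comp_map, base_comp_map, hx, hy]) ?_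
      rw [Category.assoc, Category.assoc, ha', hb']
      simp only [u, u', reassoc_of% hx', reassoc_of% hy', IsIso.hom_inv_id_assoc]
      rw [reassoc_of% s.condition]
    have uniq (m : s.pt ⟶ (incl _).obj (pullback a a')) (hm : m ≫ r ≫ inv (toSelf π V) = s.fst)
        (hm' : m ≫ r' ≫ inv (toSelf π V') = s.snd) : m = hP.lift x y hxy := by
      have hm₁ : (m ≫ (incl _).map (pullback.fst a a')) ≫ c.cart q (self π V) =
          s.fst ≫ toSelf π V := by
        rw [← hm, Category.assoc, Category.assoc, Category.assoc, IsIso.inv_hom_id,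
          Category.comp_id]
      have hm₂ : (m ≫ (incl _).map (pullback.snd a a')) ≫ c.cart q' (self π V') =
          s.snd ≫ toSelf π V' := by
        rw [← hm', Category.assoc, Category.assoc, Category.assoc, IsIso.inv_hom_id,
          Category.comp_id]
      have hb₁ := congr(base _ $hm₁)
      have hb₂ := congr(base _ $hm₂)
      rw [base_comp_cart, base_comp_map, base_comp, base_toSelf, Category.comp_id] at hb₁ hb₂
      have hb : base _ m = t := by
        apply pullback.hom_ext
        · exact hb₁.trans (pullback.lift_fst _ _ _).symm
        · exact hb₂.trans (pullback.lift_snd _ _ _).symm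
      apply hP.hom_ext
      · rw [hP.lift_fst]
        exact cart_hom_ext c (by rw [base_comp_map, hb, hx]) (by rw [hm₁, hx'])
      · rw [hP.lift_snd]
        exact cart_hom_ext c (by rw [base_comp_map, hb, hy]) (by rw [hm₂, hy'])
    refine ⟨⟨hP.lift x y hxy, ?_, ?_, fun {m} hm hm' ↦ uniq m hm hm'⟩⟩
    · change _ ≫ r ≫ _ = _
      simp only [r, Category.assoc]
      rw [hP.lift_fst_assoc, reassoc_of% hx', IsIso.hom_inv_id, Category.comp_id]
    · change _ ≫ r' ≫ _ = _
      simp only [r', Category.assoc]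
      rw [hP.lift_snd_assoc, reassoc_of% hy', IsIso.hom_inv_id, Category.comp_id]
  have (V V' Z : E) (g : V ⟶ Z) (g' : V' ⟶ Z) : HasPullback g g' :=
    (key g g').choose_spec.choose_spec.choose_spec.hasPullback
  exact hasPullbacks_of_hasLimit_cospan E

end FibredSite

/-! ### The co-vanishing site and the inclusions of the fibres -/

namespace FibredSite

variable {I : Type u₁} [Category.{w} I] {E : Type u₂} [Category.{w} E] {π : E ⥤ I}
  [π.IsFibered] [∀ i, HasFiniteLimits (π.Fiber i)] (S : FibredSite π)
  {K : GrothendieckTopology I}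

variable (K) in
/-- What holds locally in a fibre holds locally in the total category. -/
lemma loc_fibre {k : I} {V : π.Fiber k} {P : ∀ ⦃V' : π.Fiber k⦄, (V' ⟶ V) → Prop}
    (h : Loc (S.topology k) P) : Loc (S.covanishingTopology K) (U := (incl k).obj V)
      (fun U t ↦ ∃ (V' : π.Fiber k) (b : V' ⟶ V) (u : U ⟶ (incl k).obj V'), P b ∧
        t = u ≫ (incl k).map b) := by
  obtain ⟨R, hR, h⟩ := h
  refine ⟨_, Precoverage.generate_mem_toGrothendieck (IsGeneratingFamily.vertical (S := S) (K := K)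
    V R.arrows (by rwa [Sieve.generate_sieve])), ?_⟩
  rintro U t ⟨_, u, _, ⟨hb⟩, rfl⟩
  exact ⟨_, _, u, h _ hb, rfl⟩

/-- What holds locally in the base holds locally in the total category. -/
lemma loc_base {U : E} {P : ∀ ⦃i : I⦄, (i ⟶ π.obj U) → Prop} (h : Loc K P) :
    Loc (S.covanishingTopology K) (fun _ t ↦ ∃ i f g, P (i := i) f ∧ π.map t = g ≫ f) := by
  obtain ⟨R, hR, h⟩ := h
  refine ⟨_, Precoverage.generate_mem_toGrothendieck (IsGeneratingFamily.cartesian (S := S) (K := K)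
    U R.arrows (by rwa [Sieve.generate_sieve])), ?_⟩
  rintro W t ⟨Z, u, f, ⟨hf, -⟩, rfl⟩
  exact ⟨_, π.map f, π.map u, h _ hf, by simp⟩

variable (K) in
lemma coverPreserving_incl (k : I) :
    CoverPreserving (S.topology k) (S.covanishingTopology K) (incl k) where
  cover_preserve {V R} hR := by
    obtain ⟨R', hR', h⟩ := S.loc_fibre K (Loc.of_sieve hR (P := fun V' b ↦ R b) fun _ _ h ↦ h)
    refine (S.covanishingTopology K).superset_covering ?_ hR'
    intro U t ht
    obtain ⟨V', b, u, hb, rfl⟩ := h t ht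
    exact ⟨V', b, u, hb, rfl⟩

/-- Preservation of fibre products suffices for compatible families to remain compatible; the
inclusion need not preserve final objects. -/
instance isContinuous_incl (k : I) :
    (incl k : π.Fiber k ⥤ E).IsContinuous (S.topology k) (S.covanishingTopology K) := by
  refine Functor.isContinuous_of_coverPreserving ⟨?_⟩ (S.coverPreserving_incl K k)
  intro ℱ Z T x hx Y₁ Y₂ X f₁ f₂ g₁ g₂ hg₁ hg₂ h
  have := S.preservesPullbacks_incl k
  have hP := (IsPullback.of_hasPullback g₁ g₂).map (incl k)
  have hx' := congrArg (ℱ.obj.map (hP.lift f₁ f₂ h).op)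
    (hx (pullback.fst g₁ g₂) (pullback.snd g₁ g₂) hg₁ hg₂ pullback.condition)
  have e₁ := ConcreteCategory.congr_hom (ℱ.obj.map_comp ((incl k).map (pullback.fst g₁ g₂)).op
    (hP.lift f₁ f₂ h).op) (x g₁ hg₁)
  have e₂ := ConcreteCategory.congr_hom (ℱ.obj.map_comp ((incl k).map (pullback.snd g₁ g₂)).op
    (hP.lift f₁ f₂ h).op) (x g₂ hg₂)
  rw [← op_comp, hP.lift_fst] at e₁
  rw [← op_comp, hP.lift_snd] at e₂
  exact e₁.trans (hx'.trans e₂.symm)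

/-- Every object is locally above an object of a generating class, and below it in a fibre. -/
lemma loc_dense {G : ObjectProperty I} (hG : G.ι.IsCoverDense K)
    (H : ∀ i, ObjectProperty (π.Fiber i))
    (hH : ∀ i, (H i).ι.IsCoverDense (S.topology i)) (U : E) :
    Loc (S.covanishingTopology K) (fun W (t : W ⟶ U) ↦ ∃ (i : I) (V : π.Fiber i)
      (v : W ⟶ (incl i).obj V) (a : (incl i).obj V ⟶ U), G i ∧ H i V ∧ t = v ≫ a) := by
  -- Localize on the base by cartesian morphisms to reach a fibre over a generator, then vertically
  -- in that fibre.
  refine Loc.bind (S.loc_base (Loc.of_sieve (G.ι.is_cover_of_isCoverDense K (π.obj U))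
    (P := fun j f ↦ ∃ (i : I) (l : j ⟶ i) (m : i ⟶ π.obj U), G i ∧ f = l ≫ m) ?_)) ?_
  · rintro j _ ⟨⟨Z, l, m, rfl⟩⟩
    exact ⟨Z.obj, l, m, Z.property, rfl⟩
  · rintro W t ⟨_, _, g, ⟨i, l, m, hi, rfl⟩, ht⟩
    obtain ⟨v, -, hv⟩ := exists_lift S.cleavage (f := m) (t ≫ toSelf π U) (g ≫ l) (by
      rw [base_comp, base_toSelf, Category.comp_id, ht, Category.assoc])
    refine Loc.mono (Loc.pullback (S.loc_fibre K (Loc.of_sieve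
      ((H i).ι.is_cover_of_isCoverDense (S.topology i)
        ((S.cleavage.pullbackFunctor m).obj (self π U)))
      (P := fun V' b ↦ ∃ (V : π.Fiber i) (l : V' ⟶ V) (m : V ⟶ _), H i V ∧ b = l ≫ m) ?_)) v) ?_
    · rintro V' _ ⟨⟨Z, l, m, rfl⟩⟩
      exact ⟨Z.obj, l, m, Z.property, rfl⟩
    · rintro W' t' ⟨V', _, u, ⟨V, l', m', hV, rfl⟩, ht'⟩
      refine ⟨i, V, u ≫ (incl i).map l', (incl i).map m' ≫ S.cleavage.cart m (self π U) ≫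
        inv (toSelf π U), hi, hV, ?_⟩
      rw [← cancel_mono (toSelf π U), Category.assoc, ← hv, reassoc_of% ht']
      simp

/-- The total category is a `w`-site. -/
lemma isUSite_covanishingTopology (hK : IsUSite K) : IsUSite (S.covanishingTopology K) := by
  obtain ⟨G, hG, hG'⟩ := hK
  choose H hH hH' using S.isUSite
  refine ⟨fun U ↦ ∃ (i : Subtype G) (V : Subtype (H i.1)), (incl i.1).obj V.1 = U, ?_, ⟨?_⟩⟩
  · have : Small.{w} (Subtype G) := hG
    have (i : I) : Small.{w} (Subtype (H i)) := hH i
    exact small_of_surjective (α := Σ i : Subtype G, Subtype (H i.1))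
      (f := fun x ↦ (⟨_, x.1, x.2, rfl⟩ : Subtype _)) (by
        rintro ⟨_, i, V, rfl⟩
        exact ⟨⟨i, V⟩, rfl⟩)
  · intro U
    obtain ⟨R, hR, h⟩ := S.loc_dense hG' H hH' U
    refine (S.covanishingTopology K).superset_covering ?_ hR
    intro W t ht
    obtain ⟨i, V, v, a, hi, hV, rfl⟩ := h t ht
    exact ⟨⟨⟨(incl i).obj V, ⟨i, hi⟩, ⟨V, hV⟩, rfl⟩, v, a, rfl⟩⟩

end FibredSite

/-! ### Extensions of sheaves from the fibres and their fibre products -/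

section FibredGeometry

variable {I : Type u₁} [Category.{w} I] {E : Type u₂} [Category.{w} E] {π : E ⥤ I}

lemma base_cart (c : Cleavage π) {k m : I} (f : m ⟶ k) (V : π.Fiber k) :
    base V (c.cart f V) = eqToHom (obj_incl _) ≫ f := by
  have := base_comp_cart c f V (𝟙 _)
  rw [Category.id_comp] at this
  rw [this]
  simp [base]

end FibredGeometry

namespace FibredSite

variable {I : Type u₁} [Category.{w} I] {E : Type u₂} [Category.{w} E] {π : E ⥤ I}
  [π.IsFibered] [∀ i, HasFiniteLimits (π.Fiber i)] (S : FibredSite π)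
  (K : GrothendieckTopology I)

instance (k : I) : HasSheafify (S.topology k) (Type w) := (S.isUSite k).hasSheafify

variable [HasPullbacks I] [hK : Fact (IsUSite K)]

instance : HasSheafify (S.covanishingTopology K) (Type w) :=
  have := S.hasPullbacks
  (S.isUSite_covanishingTopology hK.out).hasSheafify

instance (k : I) : ((incl k : π.Fiber k ⥤ E).sheafPushforwardContinuous (Type w) (S.topology k)
    (S.covanishingTopology K)).IsRightAdjoint :=
  have := S.hasPullbacks
  (S.isUSite k).isRightAdjoint (S.isUSite_covanishingTopology hK.out) _

/-- The restriction of sheaves to a fibre. -/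
abbrev restrict (k : I) : S.CovanishingTopos K ⥤ S.FibreTopos k :=
  (incl k).sheafPushforwardContinuous (Type w) (S.topology k) (S.covanishingTopology K)

/-- The left adjoint of the restriction of sheaves to a fibre. -/
noncomputable abbrev extend (k : I) : S.FibreTopos k ⥤ S.CovanishingTopos K :=
  (incl k).sheafPullback (Type w) (S.topology k) (S.covanishingTopology K)

/-- The sheaves on the total category defined by the objects of the base. -/
noncomputable abbrev baseSheaf : I ⥤ S.CovanishingTopos K :=
  yoneda ⋙ (Functor.whiskeringLeft _ _ _).obj π.op ⋙
    presheafToSheaf (S.covanishingTopology K) (Type w)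

variable {K}

/-- The section of the sheaf of an object of the base which is defined by a morphism. -/
noncomputable def baseSec {U : E} {k : I} (f : π.obj U ⟶ k) : Sec ((S.baseSheaf K).obj k) U :=
  (toSheafify (S.covanishingTopology K) (π.op ⋙ yoneda.obj k)).app (Opposite.op U) f

@[simp]
lemma res_baseSec {U W : E} {k : I} (f : π.obj U ⟶ k) (t : W ⟶ U) :
    res t (S.baseSec (K := K) f) = S.baseSec (π.map t ≫ f) :=
  (ConcreteCategory.congr_hom ((toSheafify (S.covanishingTopology K)
    (π.op ⋙ yoneda.obj k)).naturality t.op) f).symm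

@[simp]
lemma ev_map_baseSec {U : E} {k k' : I} (f : π.obj U ⟶ k) (g : k ⟶ k') :
    ev ((S.baseSheaf K).map g) (S.baseSec f) = S.baseSec (f ≫ g) :=
  (ConcreteCategory.congr_hom (congr_app (toSheafify_naturality (S.covanishingTopology K)
    (Functor.whiskerLeft π.op (yoneda.map g))) (Opposite.op U)) f).symm

lemma loc_of_baseSec_eq {U : E} {k : I} {f f' : π.obj U ⟶ k}
    (h : S.baseSec (K := K) f = S.baseSec f') :
    Loc (S.covanishingTopology K) (fun _ t ↦ π.map t ≫ f = π.map t ≫ f') :=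
  have := S.hasPullbacks
  (S.isUSite_covanishingTopology hK.out).loc_of_toSheafify_eq h

lemma loc_baseSec {U : E} {k : I} (s : Sec ((S.baseSheaf K).obj k) U) :
    Loc (S.covanishingTopology K) (fun V t ↦ ∃ f : π.obj V ⟶ k, res t s = S.baseSec f) :=
  have := S.hasPullbacks
  (S.isUSite_covanishingTopology hK.out).loc_toSheafify s

lemma isPullback_baseSheaf {i j k l : I} {p : l ⟶ i} {q : l ⟶ j} {f : i ⟶ k} {g : j ⟶ k}
    (h : IsPullback p q f g) : IsPullback ((S.baseSheaf K).map p) ((S.baseSheaf K).map q)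
      ((S.baseSheaf K).map f) ((S.baseSheaf K).map g) := by
  refine isPullback_of_sections (by rw [← Functor.map_comp, h.w, Functor.map_comp])
    (fun U s s' hp hq ↦ ?_) (fun U x y hxy ↦ ?_)
  · refine Loc.bind ((S.loc_baseSec s).and (S.loc_baseSec s')) ?_
    rintro W t ⟨⟨a, ha⟩, ⟨a', ha'⟩⟩
    replace hp := congr(res t $hp)
    replace hq := congr(res t $hq)
    rw [← ev_res, ← ev_res, ha, ha', ev_map_baseSec, ev_map_baseSec] at hp hq
    refine ((S.loc_of_baseSec_eq hp).and (S.loc_of_baseSec_eq hq)).mono ?_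
    rintro W' t' ⟨h₁, h₂⟩
    rw [← res_res, ← res_res, ha, ha', res_baseSec, res_baseSec]
    congr 1
    exact h.hom_ext (by simpa using h₁) (by simpa using h₂)
  · refine Loc.bind ((S.loc_baseSec x).and (S.loc_baseSec y)) ?_
    rintro W t ⟨⟨a, ha⟩, ⟨b, hb⟩⟩
    replace hxy := congr(res t $hxy)
    rw [← ev_res, ← ev_res, ha, hb, ev_map_baseSec, ev_map_baseSec] at hxy
    refine (S.loc_of_baseSec_eq hxy).mono ?_
    rintro W' t' h₁
    refine ⟨S.baseSec (h.lift (π.map t' ≫ a) (π.map t' ≫ b) (by simpa using h₁)), ?_, ?_⟩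
    · rw [ev_map_baseSec, h.lift_fst, ← res_res, ha, res_baseSec]
    · rw [ev_map_baseSec, h.lift_snd, ← res_res, hb, res_baseSec]

variable (K) in
/-- The morphism from the extension of a sheaf on a fibre to the sheaf of the object of
the base. -/
noncomputable def toBase {k : I} (Z : S.FibreTopos k) :
    (S.extend K k).obj Z ⟶ (S.baseSheaf K).obj k :=
  transpose (incl k) (homOfSec (fun V _ ↦ S.baseSec (U := (incl k).obj V) (eqToHom (obj_incl V)))
    (fun V V' b _ ↦ by
      refine Eq.trans ?_ (S.res_baseSec (eqToHom (obj_incl V)) ((incl k).map b)).symm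
      rw [← base_map b]
      rfl))

@[simp]
lemma ev_toBase {k : I} {Z : S.FibreTopos k} {V : π.Fiber k} (z : Sec Z V) :
    ev (S.toBase K Z) (eta (incl k) z) = S.baseSec (eqToHom (obj_incl V)) := by
  rw [toBase, ev_transpose_eta]
  rfl

lemma ev_toBase_res {k : I} {Z : S.FibreTopos k} {V : π.Fiber k} (z : Sec Z V) {U : E}
    (v : U ⟶ (incl k).obj V) :
    ev (S.toBase K Z) (res v (eta (incl k) z)) = S.baseSec (base V v) := by
  rw [ev_res, ev_toBase, res_baseSec]
  rfl

@[simp]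
lemma map_toBase {k : I} {Z Z' : S.FibreTopos k} (a : Z ⟶ Z') :
    (S.extend K k).map a ≫ S.toBase K Z' = S.toBase K Z :=
  sheafPullback_hom_ext fun V x ↦ by simp

@[simp]
lemma map_toBase_assoc {k : I} {Z Z' : S.FibreTopos k} (a : Z ⟶ Z') {Y : S.CovanishingTopos K}
    (φ : (S.baseSheaf K).obj k ⟶ Y) :
    (S.extend K k).map a ≫ S.toBase K Z' ≫ φ = S.toBase K Z ≫ φ := by
  rw [← Category.assoc, map_toBase]

variable (K) in
/-- The extension of the inverse image of a sheaf maps to the extension of the sheaf. -/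
noncomputable def trans {m k : I} (f : m ⟶ k) (Z : S.FibreTopos k) :
    (S.extend K m).obj ((S.inverseImage f).obj Z) ⟶ (S.extend K k).obj Z :=
  transpose (incl m) (transpose (Y := (S.restrict K m).obj ((S.extend K k).obj Z))
    (S.cleavage.pullbackFunctor f)
    (homOfSec (fun V z ↦ (res (S.cleavage.cart f V) (eta (incl k) z) :
      Sec ((S.extend K k).obj Z) _)) (fun V V' b z ↦ by
        refine Eq.trans ?_ (res_res (S.cleavage.cart f V)
          ((incl m).map ((S.cleavage.pullbackFunctor f).map b)) (eta (incl k) z)).symm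
        rw [eta_res, res_res, map_pullbackFunctor_cart])))

@[simp]
lemma ev_trans {m k : I} (f : m ⟶ k) {Z : S.FibreTopos k} {V : π.Fiber k} (z : Sec Z V) :
    ev (S.trans K f Z) (eta (incl m) (eta (S.cleavage.pullbackFunctor f) z)) =
      res (S.cleavage.cart f V) (eta (incl k) z) := by
  rw [trans, ev_transpose_eta, ev_transpose_eta]
  rfl

lemma extend_inverseImage_hom_ext {m k : I} {f : m ⟶ k} {Z : S.FibreTopos k}
    {Y : S.CovanishingTopos K} {φ ψ : (S.extend K m).obj ((S.inverseImage f).obj Z) ⟶ Y}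
    (h : ∀ (V : π.Fiber k) (z : Sec Z V),
      ev φ (eta (incl m) (eta (S.cleavage.pullbackFunctor f) z)) =
        ev ψ (eta (incl m) (eta (S.cleavage.pullbackFunctor f) z))) : φ = ψ := by
  apply (((incl m).sheafAdjunctionContinuous (Type w) (S.topology m)
    (S.covanishingTopology K)).homEquiv _ _).injective
  apply sheafPullback_hom_ext
  intro V z
  rw [Adjunction.homEquiv_unit, Adjunction.homEquiv_unit]
  exact h V z

@[simp]
lemma trans_naturality {m k : I} (f : m ⟶ k) {Z Z' : S.FibreTopos k} (a : Z ⟶ Z') :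
    (S.extend K m).map ((S.inverseImage f).map a) ≫ S.trans K f Z' =
      S.trans K f Z ≫ (S.extend K k).map a := by
  apply S.extend_inverseImage_hom_ext
  intro V z
  simp

@[simp]
lemma trans_naturality_assoc {m k : I} (f : m ⟶ k) {Z Z' : S.FibreTopos k} (a : Z ⟶ Z')
    {Y : S.CovanishingTopos K} (φ : (S.extend K k).obj Z' ⟶ Y) :
    (S.extend K m).map ((S.inverseImage f).map a) ≫ S.trans K f Z' ≫ φ =
      S.trans K f Z ≫ (S.extend K k).map a ≫ φ := by
  rw [← Category.assoc, trans_naturality, Category.assoc]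

@[simp]
lemma trans_toBase {m k : I} (f : m ⟶ k) (Z : S.FibreTopos k) :
    S.trans K f Z ≫ S.toBase K Z = S.toBase K _ ≫ (S.baseSheaf K).map f := by
  apply S.extend_inverseImage_hom_ext
  intro V z
  rw [ev_comp, ev_comp, ev_trans, ev_toBase_res, ev_toBase, ev_map_baseSec, base_cart]

lemma loc_extend_inverseImage {m k : I} {f : m ⟶ k} {Z : S.FibreTopos k} {U : E}
    (s : Sec ((S.extend K m).obj ((S.inverseImage f).obj Z)) U) :
    Loc (S.covanishingTopology K) (fun U' t ↦ ∃ (V : π.Fiber k) (z : Sec Z V)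
      (v : U' ⟶ (incl m).obj ((S.cleavage.pullbackFunctor f).obj V)),
      res t s = res v (eta (incl m) (eta (S.cleavage.pullbackFunctor f) z))) := by
  refine Loc.bind (loc_sheafPullback s) ?_
  rintro U' t ⟨W, v, x, hx⟩
  refine Loc.mono (Loc.pullback (S.loc_fibre K (loc_sheafPullback x)) v) ?_
  rintro U'' t' ⟨V', b, u, ⟨V, v', z, hz⟩, hu⟩
  refine ⟨V, z, u ≫ (incl m).map v', ?_⟩
  rw [← res_res, hx, res_res, hu, ← res_res, ← eta_res, hz, eta_res, res_res]

/-- A section of the extension of f^*Z is locally a section of Z on V with a map to f⁺V, and by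
cartesianness that map is a map to V with a lift of its base through f. -/
lemma isPullback_trans {m k : I} (f : m ⟶ k) (Z : S.FibreTopos k) :
    IsPullback (S.trans K f Z) (S.toBase K _) (S.toBase K Z) ((S.baseSheaf K).map f) := by
  have := S.hasPullbacks
  have hE := S.isUSite_covanishingTopology hK.out
  have := S.preservesPullbacks_incl k
  refine isPullback_of_sections (by simp) (fun U s s' hp hq ↦ ?_) (fun U x y hxy ↦ ?_)
  · refine Loc.bind ((S.loc_extend_inverseImage s).and (S.loc_extend_inverseImage s')) ?_
    rintro U₁ t₁ ⟨⟨V, z, v, hz⟩, ⟨V', z', v', hz'⟩⟩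
    replace hp := congr(res t₁ $hp)
    replace hq := congr(res t₁ $hq)
    rw [← ev_res, ← ev_res, hz, hz'] at hp hq
    rw [ev_toBase_res, ev_toBase_res] at hq
    rw [ev_res, ev_res, ev_trans, ev_trans, res_res, res_res] at hp
    refine ((S.loc_of_baseSec_eq hq).and
      (locAgree_of_res_eta_eq (S.isUSite k) hE hp)).mono ?_
    rintro U₂ t₂ ⟨hb, V'', b, b', u, hbb, hu, hu'⟩
    obtain ⟨u', hu₁, hu₂⟩ := exists_lift S.cleavage (f := f) u (π.map t₂ ≫ base _ v) (by
      rw [← base_comp_map u b, hu, base_comp, base_comp_cart, Category.assoc])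
    have e : u' ≫ (incl m).map ((S.cleavage.pullbackFunctor f).map b) = t₂ ≫ v :=
      cart_hom_ext S.cleavage (by rw [base_comp_map, hu₁, base_comp]) (by
        rw [Category.assoc, map_pullbackFunctor_cart, reassoc_of% hu₂, hu, Category.assoc])
    have e' : u' ≫ (incl m).map ((S.cleavage.pullbackFunctor f).map b') = t₂ ≫ v' :=
      cart_hom_ext S.cleavage (by rw [base_comp_map, hu₁, base_comp, hb]) (by
        rw [Category.assoc, map_pullbackFunctor_cart, reassoc_of% hu₂, hu', Category.assoc])
    rw [← res_res, ← res_res, hz, hz', res_res, res_res, ← e, ← e', ← res_res, ← res_res,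
      ← eta_res, ← eta_res, ← eta_res, ← eta_res, hbb]
  · refine Loc.bind ((loc_sheafPullback x).and (S.loc_baseSec y)) ?_
    rintro U₁ t₁ ⟨⟨V, v, z, hz⟩, ⟨g, hg⟩⟩
    replace hxy := congr(res t₁ $hxy)
    rw [← ev_res, ← ev_res, hz, hg, ev_toBase_res, ev_map_baseSec] at hxy
    refine (S.loc_of_baseSec_eq hxy).mono ?_
    intro U₂ t₂ hb
    obtain ⟨u, hu, hu'⟩ := exists_lift S.cleavage (f := f) (t₂ ≫ v) (π.map t₂ ≫ g) (by
      rw [base_comp, hb, Category.assoc])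
    refine ⟨res u (eta (incl m) (eta (S.cleavage.pullbackFunctor f) z)), ?_, ?_⟩
    · rw [ev_res, ev_trans, res_res, hu', ← res_res, ← hz, res_res]
    · rw [ev_toBase_res, hu, ← res_res, hg, res_baseSec]

/-- The comparison of the inverse images along two morphisms and along their composite. -/
lemma exists_comp_trans {l m k : I} (p : l ⟶ m) (f : m ⟶ k) (h : l ⟶ k) (hh : p ≫ f = h)
    (Z : S.FibreTopos k) :
    ∃ δ : (S.inverseImage p).obj ((S.inverseImage f).obj Z) ⟶ (S.inverseImage h).obj Z,
      (S.extend K l).map δ ≫ S.trans K h Z = S.trans K p _ ≫ S.trans K f Z := by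
  let c := S.cleavage
  have key (V : π.Fiber k) : ∃ b : (c.pullbackFunctor p).obj ((c.pullbackFunctor f).obj V) ⟶
      (c.pullbackFunctor h).obj V, (incl l).map b ≫ c.cart h V = c.cart p _ ≫ c.cart f V := by
    obtain ⟨b, hb, hb'⟩ := exists_lift c (f := h) (c.cart p _ ≫ c.cart f V)
      (eqToHom (obj_incl _)) (by rw [base_comp_cart, base_cart, Category.assoc, hh])
    obtain ⟨b, rfl⟩ := exists_map_eq b hb
    exact ⟨b, hb'⟩
  choose b hb using key
  let δ : (S.inverseImage p).obj ((S.inverseImage f).obj Z) ⟶ (S.inverseImage h).obj Z :=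
    transpose (c.pullbackFunctor p) (transpose (Y := (S.directImage p).obj _)
      (c.pullbackFunctor f) (homOfSec (fun V z ↦ (res (b V) (eta (c.pullbackFunctor h) z) :
        Sec ((S.inverseImage h).obj Z) _)) (fun V V' a z ↦ by
          refine Eq.trans ?_ (res_res (b V) ((c.pullbackFunctor p).map
            ((c.pullbackFunctor f).map a)) (eta (c.pullbackFunctor h) z)).symm
          rw [eta_res, res_res]
          congr 1
          apply (incl l).map_injective
          refine cart_hom_ext c (by rw [base_map, base_map]) ?_
          rw [Functor.map_comp, Functor.map_comp, Category.assoc, Category.assoc,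
            map_pullbackFunctor_cart, reassoc_of% (hb V'), hb, map_pullbackFunctor_cart_assoc,
            map_pullbackFunctor_cart])))
  refine ⟨δ, ?_⟩
  apply (((incl l).sheafAdjunctionContinuous (Type w) (S.topology l)
    (S.covanishingTopology K)).homEquiv _ _).injective
  apply (((c.pullbackFunctor p).sheafAdjunctionContinuous (Type w) (S.topology m)
    (S.topology l)).homEquiv _ _).injective
  apply sheafPullback_hom_ext
  intro V z
  simp only [Adjunction.homEquiv_unit]
  change ev (S.trans K h Z) (ev ((S.extend K l).map δ) (eta (incl l) (eta (c.pullbackFunctor p)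
    (eta (c.pullbackFunctor f) z)))) = ev (S.trans K f Z) (ev (S.trans K p _)
      (eta (incl l) (eta (c.pullbackFunctor p) (eta (c.pullbackFunctor f) z))))
  have hδ : ev δ (eta (c.pullbackFunctor p) (eta (c.pullbackFunctor f) z)) =
      res (b V) (eta (c.pullbackFunctor h) z) := by
    simp only [δ]
    rw [ev_transpose_eta, ev_transpose_eta]
    rfl
  rw [ev_map_eta, hδ, eta_res, ev_res, ev_trans, res_res, hb, ev_trans, ev_res, ev_trans, res_res]

/-- Only compatibility with `trans` matters for fibre products, so the comparison morphism of
inverse images need not be known to be invertible. -/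
lemma exists_trans_comp {l m k : I} (p : l ⟶ m) (f : m ⟶ k) (h : l ⟶ k) (hh : p ≫ f = h)
    {X : S.FibreTopos m} {Z : S.FibreTopos k} (a : X ⟶ (S.inverseImage f).obj Z) :
    ∃ a' : (S.inverseImage p).obj X ⟶ (S.inverseImage h).obj Z,
      (S.extend K l).map a' ≫ S.trans K h Z =
        S.trans K p X ≫ (S.extend K m).map a ≫ S.trans K f Z := by
  obtain ⟨δ, hδ⟩ := S.exists_comp_trans (K := K) p f h hh Z
  exact ⟨(S.inverseImage p).map a ≫ δ, by rw [Functor.map_comp, Category.assoc, hδ,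
    trans_naturality_assoc]⟩

/-- The fibre products of extensions of sheaves on fibres. -/
lemma isPullback_extend {i j k l : I} {p : l ⟶ i} {q : l ⟶ j} {f : i ⟶ k} {g : j ⟶ k}
    (h : IsPullback p q f g) {X : S.FibreTopos i} {Y : S.FibreTopos j} {Z : S.FibreTopos k}
    (a : X ⟶ (S.inverseImage f).obj Z) (b : Y ⟶ (S.inverseImage g).obj Z) {P : S.FibreTopos l}
    {a' : (S.inverseImage p).obj X ⟶ (S.inverseImage (p ≫ f)).obj Z}
    {b' : (S.inverseImage q).obj Y ⟶ (S.inverseImage (p ≫ f)).obj Z}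
    (ha : (S.extend K l).map a' ≫ S.trans K _ Z =
        S.trans K p X ≫ (S.extend K i).map a ≫ S.trans K f Z)
    (hb : (S.extend K l).map b' ≫ S.trans K _ Z =
        S.trans K q Y ≫ (S.extend K j).map b ≫ S.trans K g Z)
    {r : P ⟶ (S.inverseImage p).obj X} {r' : P ⟶ (S.inverseImage q).obj Y}
    (hP : IsPullback r r' a' b') :
    IsPullback ((S.extend K l).map r ≫ S.trans K p X) ((S.extend K l).map r' ≫ S.trans K q Y)
      ((S.extend K i).map a ≫ S.trans K f Z) ((S.extend K j).map b ≫ S.trans K g Z) := by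
  have := S.hasPullbacks
  have := S.preservesPullbacks_incl l
  have := S.preservesEqualizers_incl l
  have hP' : IsPullback ((S.extend K l).map r) ((S.extend K l).map r') ((S.extend K l).map a')
      ((S.extend K l).map b') :=
    isPullback_sheafPullback_map (S.isUSite l) (S.isUSite_covanishingTopology hK.out) hP
  have hH := S.isPullback_baseSheaf (K := K) h
  have hX := S.isPullback_trans (K := K) p X
  have hY := S.isPullback_trans (K := K) q Y
  have hZ := S.isPullback_trans (K := K) (p ≫ f) Z
  refine ⟨⟨?_⟩, ⟨PullbackCone.isLimitAux' _ fun s ↦ Classical.choice ?_⟩⟩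
  · rw [Category.assoc, Category.assoc, ← ha, ← hb, reassoc_of% hP'.w]
  · have hs := s.condition
    -- The common component in the sheaf of `l` allows both legs to be lifted to extensions from the
    -- fibre over `l`, where `extend` preserves the fibre product.
    let t := hH.lift (s.fst ≫ S.toBase K X) (s.snd ≫ S.toBase K Y) (by
      have := congr($hs ≫ S.toBase K Z)
      simpa using this)
    let x := hX.lift s.fst t (hH.lift_fst _ _ _).symm
    let y := hY.lift s.snd t (hH.lift_snd _ _ _).symm
    have hx : x ≫ S.trans K p X = s.fst := hX.lift_fst _ _ _
    have hx' : x ≫ S.toBase K _ = t := hX.lift_snd _ _ _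
    have hy : y ≫ S.trans K q Y = s.snd := hY.lift_fst _ _ _
    have hy' : y ≫ S.toBase K _ = t := hY.lift_snd _ _ _
    have hxy : x ≫ (S.extend K l).map a' = y ≫ (S.extend K l).map b' := by
      apply hZ.hom_ext
      · rw [Category.assoc, Category.assoc, ha, hb, reassoc_of% hx, reassoc_of% hy, hs]
      · rw [Category.assoc, Category.assoc, map_toBase, map_toBase, hx', hy']
    have uniq (n : s.pt ⟶ (S.extend K l).obj P)
        (hn : n ≫ (S.extend K l).map r ≫ S.trans K p X = s.fst)
        (hn' : n ≫ (S.extend K l).map r' ≫ S.trans K q Y = s.snd) : n = hP'.lift x y hxy := by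
      have hnt : n ≫ S.toBase K P = t := by
        apply hH.hom_ext
        · rw [hH.lift_fst, ← hn]
          simp
        · rw [hH.lift_snd, ← hn']
          simp
      apply hP'.hom_ext
      · rw [hP'.lift_fst]
        apply hX.hom_ext
        · rw [hx, Category.assoc, hn]
        · rw [hx', Category.assoc, map_toBase, hnt]
      · rw [hP'.lift_snd]
        apply hY.hom_ext
        · rw [hy, Category.assoc, hn']
        · rw [hy', Category.assoc, map_toBase, hnt]
    refine ⟨⟨hP'.lift x y hxy, ?_, ?_, fun {n} hn hn' ↦ uniq n hn hn'⟩⟩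
    · exact (hP'.lift_fst_assoc _ _ _ _).trans hx
    · exact (hP'.lift_snd_assoc _ _ _ _).trans hy

end FibredSite

/-! ### Quasi-compactness of extensions by controlled sections -/

section FibredGeometry

variable {I : Type u₁} [Category.{w} I] {E : Type u₂} [Category.{w} E] {π : E ⥤ I}

lemma exists_cartesian [π.IsFibered] {U : E} {R : Presieve (π.obj U)} {i : I} {r : i ⟶ π.obj U}
    (hr : R r) : ∃ (Z : E) (g : Z ⟶ U), R (π.map g) ∧ π.IsCartesian (π.map g) g ∧
      ∀ ⦃W : E⦄ (h : W ⟶ U) (l : π.obj W ⟶ i), π.map h = l ≫ r → ∃ u : W ⟶ Z, h = u ≫ g := by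
  obtain ⟨Z, g, hg⟩ := IsPreFibered.exists_isCartesian π (a := U) rfl r
  obtain rfl : π.obj Z = i := IsHomLift.domain_eq π r g
  obtain rfl : r = π.map g := IsHomLift.eq_of_isHomLift π r g
  refine ⟨Z, g, hr, hg, fun W h l hl ↦ ?_⟩
  exact ⟨Functor.IsStronglyCartesian.map π (π.map g) g hl h,
    (Functor.IsStronglyCartesian.fac _ _ _ _ _).symm⟩

end FibredGeometry

/-- A quasi-compact object is covered by finitely many generators which belong to a given covering
sieve. -/
lemma IsQuasiCompactInSite.exists_finite {C : Type u₁} [Category.{w} C]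
    {K : GrothendieckTopology C} {A : ObjectProperty C} (hA : A.ι.IsCoverDense K) {X : C}
    (hX : IsQuasiCompactInSite K X) {S : Sieve X} (hS : S ∈ K X) :
    ∃ (n : ℕ) (Y : Fin n → C) (p : ∀ t, Y t ⟶ X), (∀ t, A (Y t)) ∧ (∀ t, S (p t)) ∧
      Loc K (fun Z (f : Z ⟶ X) ↦ ∃ t, ∃ g : Z ⟶ Y t, f = g ≫ p t) := by
  obtain ⟨R, hR, hfin, hcov⟩ := hX (fun Y p ↦ A Y ∧ S p) (by
    obtain ⟨S', hS', h⟩ := Loc.bind (J := K) (P := fun _ f ↦ S f)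
      (Q := fun _ f ↦ Sieve.generate (fun Y p ↦ A Y ∧ S p) f)
      (Loc.of_sieve hS fun _ _ h ↦ h) fun V f hf ↦ by
        refine Loc.of_sieve (A.ι.is_cover_of_isCoverDense K V) ?_
        rintro V' _ ⟨⟨Z, l, m, rfl⟩⟩
        exact ⟨Z.obj, l, m ≫ f, ⟨Z.property, S.downward_closed hf m⟩, by simp⟩
    exact K.superset_covering (fun _ f hf ↦ h f hf) hS')
  have := hfin.to_subtype
  obtain ⟨n, ⟨e⟩⟩ := Finite.exists_equiv_fin R.uncurry
  refine ⟨n, fun i ↦ (e.symm i).1.1, fun i ↦ (e.symm i).1.2, fun i ↦ (hR _ _ (e.symm i).2).1,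
    fun i ↦ (hR _ _ (e.symm i).2).2, Loc.of_sieve hcov ?_⟩
  rintro Z _ ⟨Y, g, p, hp, rfl⟩
  have key : ∀ x : R.uncurry, x = ⟨⟨Y, p⟩, hp⟩ → ∃ g' : Z ⟶ x.1.1, g ≫ p = g' ≫ x.1.2 := by
    rintro _ rfl
    exact ⟨g, rfl⟩
  exact ⟨e ⟨⟨Y, p⟩, hp⟩, key _ (by simp)⟩

namespace FibredSite

variable {I : Type u₁} [Category.{w} I] {E : Type u₂} [Category.{w} E] {π : E ⥤ I}
  [π.IsFibered] [∀ i, HasFiniteLimits (π.Fiber i)] (S : FibredSite π)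
  {K : GrothendieckTopology I}

section QuasiCompact

variable {S} {F : S.CovanishingTopos K}

/-- The action on sections of a morphism to a restriction. -/
def evRes {j : I} {Y : S.FibreTopos j} (σ : Y ⟶ (S.restrict K j).obj F) {V : π.Fiber j}
    (y : Sec Y V) : Sec F ((incl j).obj V) := ev σ y

@[simp]
lemma evRes_res {j : I} {Y : S.FibreTopos j} (σ : Y ⟶ (S.restrict K j).obj F)
    {V V' : π.Fiber j} (b : V' ⟶ V) (y : Sec Y V) :
    evRes σ (res b y) = res ((incl j).map b) (evRes σ y) := ev_res σ b y

@[simp]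
lemma evRes_comp {j : I} {Y Y' : S.FibreTopos j} (φ : Y' ⟶ Y)
    (σ : Y ⟶ (S.restrict K j).obj F) {V : π.Fiber j} (y : Sec Y' V) :
    evRes (φ ≫ σ) y = evRes σ (ev φ y) := rfl

/-- The sections that a morphism maps to a closed subpresheaf. -/
def ClosedSubComap (N : ClosedSub F) {j : I} {Y : S.FibreTopos j}
    (σ : Y ⟶ (S.restrict K j).obj F) : ClosedSub Y where
  mem y := N.mem (evRes σ y)
  res_mem f s hs := by
    rw [evRes_res]
    exact N.res_mem _ hs
  of_loc {U s} h := by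
    refine N.of_loc ((S.loc_fibre K h).mono ?_)
    rintro W t ⟨V, b, u, hb, rfl⟩
    rw [evRes_res] at hb
    rw [← res_res]
    exact N.res_mem _ hb

variable {Λ : Type*} (N : Λ → ClosedSub F)

/-- A morphism to a restriction has image in a member of a family of closed subpresheaves. -/
def LandsIn {j : I} {Y : S.FibreTopos j} (σ : Y ⟶ (S.restrict K j).obj F) : Prop :=
  ∃ l : Λ, ∀ (V : π.Fiber j) (y : Sec Y V), (N l).mem (evRes σ y)

/-- A morphism to a restriction all of whose values are locally restrictions of a section. -/
def ComesFrom {U : E} (s : Sec F U) {j : I} {Y : S.FibreTopos j}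
    (σ : Y ⟶ (S.restrict K j).obj F) : Prop :=
  ∀ (V : π.Fiber j) (y : Sec Y V), Loc (S.topology j) (fun V' b ↦
    ∃ u : (incl j).obj V' ⟶ U, evRes σ (res b y) = res u s)

/-- A section is controlled by a family of closed subpresheaves if the morphisms
from coherent sheaves on fibres which come from the section have image in members of the family. -/
def IsControlled (A : ObjectProperty I) {U : E} (s : Sec F U) : Prop :=
  ∀ ⦃j : I⦄, A j → ∀ (Y : S.FibreTopos j), IsCoherent Y →
    ∀ σ : Y ⟶ (S.restrict K j).obj F, ComesFrom s σ → LandsIn N σ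

variable {N} {A : ObjectProperty I}

lemma IsControlled.res {U W : E} {s : Sec F U} (hs : IsControlled N A s) (f : W ⟶ U) :
    IsControlled N A (res f s) := fun _ hj Y hY σ hσ ↦ hs hj Y hY σ fun V y ↦
  (hσ V y).mono fun V' b ⟨u, hu⟩ ↦ ⟨u ≫ f, by rw [hu, res_res]⟩

/-- The values of the morphism are locally restrictions of `s`, and membership in `N l` is stable
under restriction and local. -/
lemma isControlled_of_mem {U : E} {s : Sec F U} {l : Λ} (hs : (N l).mem s) :
    IsControlled N A s := fun _ _ _ _ σ hσ ↦ ⟨l, fun V y ↦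
  (ClosedSubComap (N l) σ).of_loc ((hσ V y).mono fun V' b ⟨u, hu⟩ ↦ by
    change (N l).mem (evRes σ _)
    rw [hu]
    exact (N l).res_mem u hs)⟩

lemma comesFrom_ofSec {j : I} {Y Y' : S.FibreTopos j} (σ : Y ⟶ (S.restrict K j).obj F)
    {V : π.Fiber j} (y : Sec Y V) (ψ : Y' ⟶ eps (S.topology j) V) {U : E} (s : Sec F U)
    (u : (incl j).obj V ⟶ U) (h : evRes σ y = Covanishing.res u s) :
    ComesFrom s (ψ ≫ ofSec y ≫ σ) := fun V' y' ↦
  (loc_eps (ev ψ y')).mono fun V'' b ⟨v, hv⟩ ↦ ⟨(incl j).map v ≫ u, by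
    rw [evRes_comp, evRes_comp, ev_res, hv, ev_res, ev_ofSec, evRes_res, h, res_res]⟩

variable (hN : ∀ (n : ℕ) (l : Fin n → Λ), ∃ c, ∀ i ⦃U : E⦄ (s : Sec F U),
  (N (l i)).mem s → (N c).mem s)
include hN

/-- Algebraicity covers `Y` by coherent sheaves that factor through the given sections; finitely
many suffice, and directedness of `N` provides one index for all. -/
lemma landsIn_of_loc {j : I} (hj : IsAlgebraicTopos (S.FibreTopos j)) {Y : S.FibreTopos j}
    (hY : IsQuasiCompact Y) (σ : Y ⟶ (S.restrict K j).obj F)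
    (P : ∀ ⦃V : π.Fiber j⦄, Sec Y V → Prop)
    (hP : ∀ ⦃V : π.Fiber j⦄ (y : Sec Y V), Loc (S.topology j) (fun _ b ↦ P (res b y)))
    (h : ∀ (Y' : S.FibreTopos j), IsCoherent Y' → ∀ (V : π.Fiber j) (y : Sec Y V), P y →
      ∀ ψ : Y' ⟶ eps (S.topology j) V, LandsIn N (ψ ≫ ofSec y ≫ σ)) : LandsIn N σ := by
  obtain ⟨G, hG, hG'⟩ := hj
  obtain ⟨n, Y', φ, hφ, hepi⟩ := hY.exists_finite (isEpimorphicFamily_of_separating hG Y P hP)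
  choose hY' V y hy ψ hψ using hφ
  choose l hl using fun t ↦ h (Y' t) (hG' _ (hY' t)).1 (V t) (y t) (hy t) (ψ t)
  obtain ⟨c, hc⟩ := hN n l
  refine ⟨c, fun V' y' ↦ mem_of_isEpimorphicFamily hepi.isEpimorphicFamily
    (ClosedSubComap (N c) σ) ?_ y'⟩
  rintro _ _ ⟨t⟩ U s
  rw [hψ]
  exact hc t _ (hl t U s)

/-- The inverse image of the vertical cover on the fibre over `j` is still a cover, by continuity,
so the values of `σ` come locally from restrictions of `s` that are controlled. The map `f` from an
arbitrary `W` is kept for the later induction. -/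
lemma isControlled_of_vertical {k : I} {V : π.Fiber k} {R : Presieve V}
    (hA : ∀ j, A j → IsAlgebraicTopos (S.FibreTopos j))
    (hR : Sieve.generate R ∈ S.topology k V) {W : E} (f : W ⟶ (incl k).obj V) (s : Sec F W)
    (hs : ∀ ⦃W' : E⦄ (t : W' ⟶ W), Sieve.generate (R.map (incl k)) (t ≫ f) →
      IsControlled N A (res t s)) : IsControlled N A s := by
  intro j hj Y hY σ hσ
  refine landsIn_of_loc hN (hA j hj) hY.1 σ (fun V' y ↦ ∃ t : (incl j).obj V' ⟶ W,
    Sieve.generate (R.map (incl k)) (t ≫ f) ∧ evRes σ y = Covanishing.res t s) ?_ ?_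
  · intro V' y
    refine Loc.bind (hσ V' y) ?_
    rintro V₁ b ⟨u, hu⟩
    let c := S.cleavage
    let g : j ⟶ k := eqToHom (obj_incl V₁).symm ≫ base V (u ≫ f)
    obtain ⟨v, hv, hv'⟩ := exists_lift c (f := g) (u ≫ f) (eqToHom (obj_incl V₁)) (by simp [g])
    obtain ⟨v, rfl⟩ := exists_map_eq v hv
    have := (CoverPreserving.of_isContinuous (c.pullbackFunctor g) (S.topology k)
      (S.topology j)).cover_preserve hR
    refine Loc.of_sieve ((S.topology j).pullback_stable v this) ?_
    rintro V₂ b' ⟨V₃, r, d, ⟨V₄, r₁, r₂, hr, rfl⟩, hd⟩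
    refine ⟨(incl j).map b' ≫ u, ⟨(incl k).obj V₄, (incl j).map d ≫ c.cart g V₃ ≫
      (incl k).map r₁, (incl k).map r₂, ⟨hr⟩, ?_⟩, ?_⟩
    · have := congr((incl j).map $hd ≫ c.cart g V)
      rw [Functor.map_comp, Functor.map_comp, Category.assoc, hv', Category.assoc,
        map_pullbackFunctor_cart] at this
      simpa using this.symm
    · rw [← res_res, evRes_res, hu, res_res]
  · rintro Y' hY' V' y ⟨t, ht, hy⟩ ψ
    exact hs t ht hj Y' hY' _ (comesFrom_ofSec σ y ψ _ (𝟙 _) (by rw [hy, res_id]))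

/-- A cover of the base cannot be seen inside the fibre over `j`. Quasi-compactness of `j` reduces
it to finitely many p : i ⟶ j, and the morphism is tested on the inverse images of its source along
them, which are again coherent. -/
lemma isControlled_of_cartesian {U : E} {R : Presieve (π.obj U)}
    (hA : ∀ j, A j → IsAlgebraicTopos (S.FibreTopos j)) (hA' : A.ι.IsCoverDense K)
    (hAK : ∀ j, A j → IsQuasiCompactInSite K j)
    (htrans : ∀ ⦃i j : I⦄ (f : i ⟶ j), A i → A j → IsCoherentInverseImage (S.inverseImage f))
    (hR : Sieve.generate R ∈ K (π.obj U)) {W : E} (f : W ⟶ U) (s : Sec F W)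
    (hs : ∀ ⦃W' : E⦄ (t : W' ⟶ W), Sieve.generate
      (fun _ g ↦ R (π.map g) ∧ π.IsCartesian (π.map g) g : Presieve U) (t ≫ f) →
      IsControlled N A (res t s)) : IsControlled N A s := by
  intro j hj Y hY σ hσ
  refine landsIn_of_loc hN (hA j hj) hY.1 σ (fun V' y ↦ ∃ t : (incl j).obj V' ⟶ W,
    evRes σ y = Covanishing.res t s) ?_ ?_
  · exact fun V' y ↦ (hσ V' y)
  rintro Y' hY' V y ⟨t, ht⟩ ψ
  let c := S.cleavage
  -- All values of the morphism out of `Y'` now come through the single map `t`, so one base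
  -- morphism `g` serves for the whole sheaf.
  let g : j ⟶ π.obj U := eqToHom (obj_incl V).symm ≫ π.map (t ≫ f)
  obtain ⟨n, i, p, hi, hp, hcov⟩ := (hAK j hj).exists_finite hA' (K.pullback_stable g hR)
  let τ := ψ ≫ ofSec y ≫ σ
  let σ' (a : Fin n) : (S.inverseImage (p a)).obj Y' ⟶ (S.restrict K (i a)).obj F :=
    transpose (c.pullbackFunctor (p a)) (homOfSec (fun V z ↦
      (res (c.cart (p a) V) (evRes τ z) : Sec F _)) (fun V V' b z ↦ by
        refine Eq.trans ?_ (res_res (c.cart (p a) V)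
          ((incl (i a)).map ((c.pullbackFunctor (p a)).map b)) (evRes τ z)).symm
        rw [evRes_res, res_res, map_pullbackFunctor_cart]))
  have hσ' (a : Fin n) {V' : π.Fiber j} (z : Sec Y' V') :
      evRes (σ' a) (eta (c.pullbackFunctor (p a)) z) = res (c.cart (p a) V') (evRes τ z) := by
    exact ev_transpose_eta _ _
  have hland (a : Fin n) : LandsIn N (σ' a) := by
    refine hs (c.cart (p a) V ≫ t) ?_ (hi a) _ (htrans (p a) (hi a) hj Y' hY') _ ?_
    · obtain ⟨k, l, r, hr, hlr⟩ := hp a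
      obtain ⟨Z, m, hm, hm', hm''⟩ := exists_cartesian hr
      obtain ⟨u, hu⟩ := hm'' ((c.cart (p a) V ≫ t) ≫ f) (eqToHom (obj_incl _) ≫ l) (by
        rw [Category.assoc, Category.assoc, hlr, Functor.map_comp]
        have := base_cart c (p a) V
        rw [base] at this
        simp only [g]
        rw [← reassoc_of% this]
        simp)
      exact ⟨Z, u, m, ⟨hm, hm'⟩, hu.symm⟩
    · intro V₁ y₁
      refine Loc.bind (loc_sheafPullback y₁) ?_
      rintro V₂ b₂ ⟨V₃, v, z, hz⟩
      have hcov' := (CoverPreserving.of_isContinuous (c.pullbackFunctor (p a)) (S.topology j)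
        (S.topology (i a)))
      obtain ⟨Q, hQ, hQ'⟩ := loc_eps (ev ψ z)
      refine Loc.of_sieve ((S.topology (i a)).pullback_stable v (hcov'.cover_preserve hQ)) ?_
      rintro V₄ b₄ ⟨V₅, q, d, hq, hd⟩
      obtain ⟨x, hx⟩ := hQ' q hq
      refine ⟨(incl (i a)).map (d ≫ (c.pullbackFunctor (p a)).map x), ?_⟩
      rw [← res_res, hz, res_res, hd, ← res_res, ← eta_res, evRes_res, hσ']
      simp only [τ]
      rw [evRes_comp, evRes_comp, ev_res, hx, ev_res, ev_ofSec, evRes_res, ht]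
      simp
  choose l hl using hland
  obtain ⟨e, he⟩ := hN n l
  refine ⟨e, fun V' z ↦ (N e).of_loc ?_⟩
  -- The finite cover of `j` gives a cartesian cover of `V'`, on whose members the section restricts
  -- to a value of some `σ' a`.
  have hloc := S.loc_base (U := (incl j).obj V') (hcov.pullback (eqToHom (obj_incl V')))
  refine hloc.mono ?_
  rintro W' t' ⟨i', f', g', ⟨a, m, hm⟩, ht'⟩
  obtain ⟨v, -, hv⟩ := exists_lift c (f := p a) (V := V') t' (g' ≫ m) (by
    rw [Category.assoc, ← hm, ← Category.assoc, ← ht']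
    rfl)
  rw [← hv, ← res_res]
  refine (N e).res_mem _ (he a _ ?_)
  have := hl a _ (eta (c.pullbackFunctor (p a)) z)
  rwa [hσ'] at this

lemma isControlled_of_loc
    (hA : ∀ j, A j → IsAlgebraicTopos (S.FibreTopos j)) (hA' : A.ι.IsCoverDense K)
    (hAK : ∀ j, A j → IsQuasiCompactInSite K j)
    (htrans : ∀ ⦃i j : I⦄ (f : i ⟶ j), A i → A j → IsCoherentInverseImage (S.inverseImage f))
    {U : E} (s : Sec F U) (hs : Loc (S.covanishingTopology K) (fun _ t ↦
      IsControlled N A (res t s))) : IsControlled N A s := by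
  obtain ⟨R, hR, hs⟩ := hs
  -- Quantifying over all W ⟶ U builds base change into the induction, so that the pullback case is
  -- composition.
  have key : ∀ (U : E) (R : Sieve U), R ∈ S.covanishingTopology K U → ∀ (W : E) (f : W ⟶ U)
      (s : Sec F W), (∀ ⦃W' : E⦄ (t : W' ⟶ W), R (t ≫ f) → IsControlled N A (res t s)) →
      IsControlled N A s := by
    intro U R hR
    induction hR with
    | of U R hR =>
      intro W f s hs
      cases hR with
      | vertical V R hR => exact isControlled_of_vertical hN hA hR f s hs
      | cartesian V R hR => exact isControlled_of_cartesian hN hA hA' hAK htrans hR f s hs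
    | top U =>
      intro W f s hs
      simpa using hs (𝟙 W) trivial
    | pullback U R _ V g ih =>
      intro W f s hs
      exact ih W (f ≫ g) s fun W' t ht ↦ hs t (by simpa using ht)
    | transitive U R R' _ _ ih ih' =>
      intro W f s hs
      refine ih W f s fun W' t ht ↦ ?_
      refine ih' ht W' (𝟙 _) _ fun W'' t' ht' ↦ ?_
      rw [res_res]
      exact hs _ (by simpa using ht')
  exact key U R hR U (𝟙 U) s fun W' t ht ↦ hs t (by simpa using ht)

variable [HasPullbacks I] [hK : Fact (IsUSite K)]

omit hN in
/-- The extensions of the quasi-compact sheaves on fibres are quasi-compact. -/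
lemma isQuasiCompact_extend
    (hA : ∀ j, A j → IsAlgebraicTopos (S.FibreTopos j)) (hA' : A.ι.IsCoverDense K)
    (hAK : ∀ j, A j → IsQuasiCompactInSite K j)
    (htrans : ∀ ⦃i j : I⦄ (f : i ⟶ j), A i → A j → IsCoherentInverseImage (S.inverseImage f))
    {i : I} (hi : A i) {X : S.FibreTopos i} (hX : IsQuasiCompact X) :
    IsQuasiCompact ((S.extend K i).obj X) := by
  intro R hR
  -- Finite subfamilies are directed under union; the empty union covers the case of no index.
  let Λ := { L : Set (Σ Y, Y ⟶ (S.extend K i).obj X) // L ⊆ R.uncurry ∧ L.Finite }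
  let N (L : Λ) : ClosedSub ((S.extend K i).obj X) := ClosedSub.ofLoc
    (fun U s ↦ ∃ x ∈ L.1, ∃ y : Sec x.1 U, ev x.2 y = s)
  have hN (n : ℕ) (l : Fin n → Λ) : ∃ c, ∀ i ⦃U : E⦄ (s : Sec ((S.extend K _).obj X) U),
      (N (l i)).mem s → (N c).mem s := by
    refine ⟨⟨⋃ i, (l i).1, Set.iUnion_subset fun i ↦ (l i).2.1,
      Set.finite_iUnion fun i ↦ (l i).2.2⟩, fun i U s hs ↦ hs.mono ?_⟩
    rintro V t ⟨x, hx, y, hy⟩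
    exact ⟨x, Set.mem_iUnion_of_mem i hx, y, hy⟩
  let M : ClosedSub ((S.extend K i).obj X) :=
    { mem := fun s ↦ IsControlled N A s
      res_mem := fun f s hs ↦ hs.res f
      of_loc := fun h ↦ isControlled_of_loc hN hA hA' hAK htrans _ h }
  have hM {U : E} (s : Sec ((S.extend K i).obj X) U) : IsControlled N A s := by
    refine mem_of_isEpimorphicFamily hR M ?_ s
    intro Y φ hφ U y
    refine isControlled_of_mem (l := ⟨{⟨Y, φ⟩}, Set.singleton_subset_iff.2 hφ,
      Set.finite_singleton _⟩) ?_
    refine Loc.of_forall fun V t ↦ ⟨⟨Y, φ⟩, rfl, res t y, by simp⟩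
  let σ : X ⟶ (S.restrict K i).obj ((S.extend K i).obj X) :=
    ((incl i).sheafAdjunctionContinuous (Type w) (S.topology i)
      (S.covanishingTopology K)).unit.app X
  -- Each section of `X` gives a controlled section of the extension; quasi-compactness of `X` then
  -- yields one finite subfamily for the whole unit.
  obtain ⟨L, hL⟩ : LandsIn N σ := landsIn_of_loc hN (hA i hi) hX σ (fun _ _ ↦ True)
    (fun _ _ ↦ Loc.of_forall fun _ _ ↦ trivial) fun Y' hY' V y _ ψ ↦
      hM _ hi Y' hY' _ (comesFrom_ofSec σ y ψ (evRes σ y) (𝟙 _) (by simp))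
  refine ⟨fun Y f ↦ (⟨Y, f⟩ : Σ Y, Y ⟶ (S.extend K i).obj X) ∈ L.1, fun Y f hf ↦ L.2.1 hf,
    L.2.2.subset fun x hx ↦ hx, isEpimorphicFamily_of_loc ?_⟩
  intro U s
  have : (N L).mem s := (N L).of_loc ((loc_sheafPullback s).mono fun W t ⟨V, v, x, hx⟩ ↦ by
    rw [hx]
    exact (N L).res_mem _ (hL V x))
  refine this.mono ?_
  rintro V t ⟨x, hx, y, hy⟩
  exact ⟨x.1, x.2, hx, y, hy⟩

end QuasiCompact

end FibredSite

/-! ### Presentations by coherent sheaves and the coherent basis -/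

lemma epiFamiliesUniversal_sheaf {C : Type u₁} [Category.{w} C] (J : GrothendieckTopology C)
    [HasSheafify J (Type w)] : EpiFamiliesUniversal (Sheaf J (Type w)) :=
  fun _ _ _ hR g ↦ isEpimorphicFamily_pullback hR g

lemma isCoverDense_top {C : Type u₁} [Category.{w} C] (J : GrothendieckTopology C) :
    (⊤ : ObjectProperty C).ι.IsCoverDense J where
  is_cover U := by
    convert J.top_mem U
    rw [← Sieve.id_mem_iff_eq_top]
    exact ⟨⟨⟨U, trivial⟩, 𝟙 U, 𝟙 U, by simp⟩⟩

section Terminal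

variable {C : Type u₁} [Category.{w} C] {J : GrothendieckTopology C}

/-- A sheaf all of whose sets of sections are singletons is a final object. -/
noncomputable def isTerminalOfSections (F : Sheaf J (Type w)) (s : ∀ U, Sec F U)
    (hs : ∀ U (s' : Sec F U), s' = s U) : IsTerminal F :=
  IsTerminal.ofUniqueHom (fun _ ↦ homOfSec (fun U _ ↦ s U) (fun _ _ _ _ ↦ (hs _ _).symm))
    (fun _ _ ↦ sheaf_hom_ext fun U _ ↦ (hs U _).trans (hs U _).symm)

/-- The section of the final sheaf. -/
noncomputable def terminalSec (J : GrothendieckTopology C) [HasSheafify J (Type w)] (U : C) :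
    Sec (⊤_ Sheaf J (Type w)) U :=
  ev (terminal.from (eps J U)) (genSec J U)

lemma eq_terminalSec [HasSheafify J (Type w)] {U : C} (s : Sec (⊤_ Sheaf J (Type w)) U) :
    s = terminalSec J U := by
  rw [terminalSec, ← ev_ofSec s, Subsingleton.elim (ofSec s) (terminal.from _)]

end Terminal

namespace FibredSite

variable {I : Type u₁} [Category.{w} I] {E : Type u₂} [Category.{w} E] {π : E ⥤ I}
  [π.IsFibered] [∀ i, HasFiniteLimits (π.Fiber i)] (S : FibredSite π)

-- The inverse image functors preserve final objects, so a morphism to the final object of the fibre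
-- over `i` exists in the fibre of its source. With the next lemma, that object is final in E.
include S in
lemma exists_hom_terminal {i : I} (hi : IsTerminal i) (U : E) :
    Nonempty (U ⟶ (incl i).obj (⊤_ π.Fiber i)) := by
  let f := hi.from (π.obj U)
  let h : IsTerminal ((S.cleavage.pullbackFunctor f).obj (⊤_ π.Fiber i)) :=
    terminalIsTerminal.isTerminalObj _ _
  exact ⟨toSelf π U ≫ (incl _).map (h.from _) ≫ S.cleavage.cart f _⟩

include S in
lemma hom_terminal_ext {i : I} (hi : IsTerminal i) {U : E}
    (u v : U ⟶ (incl i).obj (⊤_ π.Fiber i)) : u = v := by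
  let f := hi.from (π.obj U)
  let h : IsTerminal ((S.cleavage.pullbackFunctor f).obj (⊤_ π.Fiber i)) :=
    terminalIsTerminal.isTerminalObj _ _
  have key (u : U ⟶ (incl i).obj (⊤_ π.Fiber i)) :
      u = toSelf π U ≫ (incl _).map (h.from _) ≫ S.cleavage.cart f _ := by
    obtain ⟨u, hu, rfl⟩ := exists_lift S.cleavage (f := f) u (𝟙 _) (hi.hom_ext _ _)
    obtain ⟨u, rfl⟩ := exists_fibre_hom u hu
    rw [h.hom_ext u (h.from _), Category.assoc]
  rw [key u, key v]

variable {K : GrothendieckTopology I} [HasPullbacks I] [hK : Fact (IsUSite K)]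

variable {S} in
lemma extend_eps_hom_ext {i : I} {V : π.Fiber i} {G : S.CovanishingTopos K}
    {φ ψ : (S.extend K i).obj (eps (S.topology i) V) ⟶ G}
    (h : ev φ (eta (incl i) (genSec (S.topology i) V)) =
      ev ψ (eta (incl i) (genSec (S.topology i) V))) : φ = ψ := by
  apply (((incl i).sheafAdjunctionContinuous (Type w) (S.topology i)
    (S.covanishingTopology K)).homEquiv _ _).injective
  apply eps_hom_ext
  rw [Adjunction.homEquiv_unit, Adjunction.homEquiv_unit]
  exact h

/-- The morphism from the extension of a representable sheaf on a fibre which is defined by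
a section. -/
noncomputable def extendSec {F : S.CovanishingTopos K} {i : I} {V : π.Fiber i}
    (x : Sec F ((incl i).obj V)) : (S.extend K i).obj (eps (S.topology i) V) ⟶ F :=
  transpose (incl i) (ofSec (F := (S.restrict K i).obj F) x)

@[simp]
lemma ev_extendSec {F : S.CovanishingTopos K} {i : I} {V : π.Fiber i}
    (x : Sec F ((incl i).obj V)) :
    ev (S.extendSec x) (eta (incl i) (genSec (S.topology i) V)) = x := by
  rw [extendSec, ev_transpose_eta]
  exact ev_ofSec (F := (S.restrict K i).obj F) x

/-- A sheaf is covered by the extensions of coherent sheaves on fibres which map to it through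
sections which have a given property, if the sections locally have this property. -/
lemma isEpimorphicFamily_extend {A : ObjectProperty I}
    (hA : ∀ j, A j → IsAlgebraicTopos (S.FibreTopos j)) (F : S.CovanishingTopos K)
    (P : ∀ ⦃i : I⦄ ⦃V : π.Fiber i⦄, Sec F ((incl i).obj V) → Prop)
    (hP : ∀ ⦃U : E⦄ (s : Sec F U), Loc (S.covanishingTopology K) (fun W t ↦ ∃ (i : I)
      (V : π.Fiber i) (v : W ⟶ (incl i).obj V) (x : Sec F ((incl i).obj V)), A i ∧ P x ∧
      res t s = res v x)) :
    IsEpimorphicFamily (fun (Y : S.CovanishingTopos K) (φ : Y ⟶ F) ↦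
      ∃ (i : I) (X : S.FibreTopos i) (V : π.Fiber i) (x : Sec F ((incl i).obj V))
        (ψ : X ⟶ eps (S.topology i) V) (e : Y ≅ (S.extend K i).obj X), A i ∧ IsCoherent X ∧
        P x ∧ φ = e.hom ≫ (S.extend K i).map ψ ≫ S.extendSec x) := by
  intro Z a b hab
  apply sheaf_hom_ext
  intro U s
  apply sec_ext
  refine (hP s).mono ?_
  rintro W t ⟨i, V, v, x, hi, hx, ht⟩
  let x' : Sec ((S.restrict K i).obj F) V := x
  have key : ofSec x' ≫ (S.restrict K i).map a = ofSec x' ≫ (S.restrict K i).map b := by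
    obtain ⟨G, hG, hG'⟩ := hA i hi
    apply hG
    intro X hX ψ
    have h := hab ((S.extend K i).map ψ ≫ S.extendSec x)
      ⟨i, X, V, x, ψ, Iso.refl _, hi, (hG' X hX).1, hx, by simp⟩
    apply sheaf_hom_ext
    intro V' y
    have h' := congr(ev $h (eta (incl i) y))
    simp only [ev_comp, ev_map_eta, extendSec, ev_transpose_eta] at h'
    exact h'
  have key' : ev a x = ev b x := by
    have := congr(ev $key (genSec (S.topology i) V))
    rw [ev_comp, ev_comp, ev_ofSec] at this
    exact this
  rw [← ev_res, ← ev_res, ht, ev_res, ev_res, key']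

variable (K) in
/-- A presentation of an object of the co-vanishing topos as the extension of a coherent sheaf
on a fibre. -/
structure Presentation (A : ObjectProperty I) (F : S.CovanishingTopos K) where
  /-- the object of the base -/
  base : I
  base_mem : A base
  /-- the sheaf on the fibre -/
  sheaf : S.FibreTopos base
  isCoherent : IsCoherent sheaf
  /-- the isomorphism with the extension -/
  iso : F ≅ (S.extend K base).obj sheaf

variable {S} in
/-- A morphism which is defined by a morphism of the base and by a morphism of coherent sheaves
on a fibre. -/
def Presentation.IsPresented {A : ObjectProperty I} {F G : S.CovanishingTopos K}
    (p : S.Presentation K A G) (φ : F ⟶ G) : Prop :=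
  ∃ (q : S.Presentation K A F) (f : q.base ⟶ p.base)
    (a : q.sheaf ⟶ (S.inverseImage f).obj p.sheaf),
    φ ≫ p.iso.hom = q.iso.hom ≫ (S.extend K q.base).map a ≫ S.trans K f p.sheaf

variable {A : ObjectProperty I}

/-- A section of `F` is locally defined on an object over some i in `A`, where its image in the
extension of `Z` comes from a section of f^*Z; that section defines the required morphism to f^*Z.
-/
lemma isEpimorphicFamily_isPresented (hA : ∀ j, A j → IsAlgebraicTopos (S.FibreTopos j))
    (hA' : A.ι.IsCoverDense K) {F G : S.CovanishingTopos K} (p : S.Presentation K A G)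
    (u : F ⟶ G) :
    IsEpimorphicFamily (fun (Y : S.CovanishingTopos K) (a : Y ⟶ F) ↦
      p.IsPresented (a ≫ u)) := by
  obtain ⟨k, hk, Z, hZ, e⟩ := p
  refine (S.isEpimorphicFamily_extend hA F (fun i V x ↦ ∃ (f : i ⟶ k)
    (z : Sec ((S.inverseImage f).obj Z) V),
    ev (u ≫ e.hom) x = ev (S.trans K f Z) (eta (incl i) z)) fun U s ↦ ?_).mono ?_
  · refine Loc.bind (loc_sheafPullback (ev (u ≫ e.hom) s)) ?_
    rintro U' t ⟨W, v, z, hz⟩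
    refine (S.loc_dense hA' (fun _ ↦ ⊤) (fun i ↦ isCoverDense_top _) U').mono ?_
    rintro U'' t' ⟨i, V, v', a, hi, -, rfl⟩
    let f : i ⟶ k := eqToHom (obj_incl V).symm ≫ base W (a ≫ v)
    obtain ⟨v₁, hv₁, hv₂⟩ := exists_lift S.cleavage (f := f) (a ≫ v) (eqToHom (obj_incl V))
      (by simp [f])
    obtain ⟨v₁, rfl⟩ := exists_map_eq v₁ hv₁
    refine ⟨i, V, v', res (a ≫ t) s, hi, ⟨f, res v₁ (eta (S.cleavage.pullbackFunctor f) z), ?_⟩,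
      by simp⟩
    rw [eta_res, ev_res, ev_res, ev_trans, res_res, hv₂, ← res_res, hz, res_res]
  · rintro Y φ ⟨i, X, V, x, ψ, e', hi, hX, ⟨f, z, hz⟩, rfl⟩
    refine ⟨⟨i, hi, X, hX, e'⟩, f, ψ ≫ ofSec z, ?_⟩
    have : S.extendSec x ≫ u ≫ e.hom = (S.extend K i).map (ofSec z) ≫ S.trans K f Z :=
      extend_eps_hom_ext (by rw [ev_comp, ev_extendSec, hz, ev_comp, ev_map_eta, ev_ofSec])
    simp only [Category.assoc, this, Functor.map_comp]

lemma isEpimorphicFamily_presentation (hA : ∀ j, A j → IsAlgebraicTopos (S.FibreTopos j))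
    (hA' : A.ι.IsCoverDense K) (F : S.CovanishingTopos K) :
    IsEpimorphicFamily (fun (Y : S.CovanishingTopos K) (_ : Y ⟶ F) ↦
      Nonempty (S.Presentation K A Y)) := by
  refine (S.isEpimorphicFamily_extend hA F (fun _ _ _ ↦ True) fun U s ↦ ?_).mono ?_
  · refine (S.loc_dense hA' (fun _ ↦ ⊤) (fun i ↦ isCoverDense_top _) U).mono ?_
    rintro U' t ⟨i, V, v, a, hi, -, rfl⟩
    exact ⟨i, V, v, res a s, hi, trivial, by simp⟩
  · rintro Y _ ⟨i, X, -, -, -, e, hi, hX, -⟩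
    exact ⟨⟨i, hi, X, hX, e⟩⟩

lemma Presentation.pullback (hA : ∀ j, A j → IsAlgebraicTopos (S.FibreTopos j))
    (hA' : ∀ ⦃i j k : I⦄ (f : i ⟶ k) (g : j ⟶ k), A i → A j → A k →
      ∃ (l : I) (p : l ⟶ i) (q : l ⟶ j), A l ∧ IsPullback p q f g)
    (htrans : ∀ ⦃i j : I⦄ (f : i ⟶ j), A i → A j → IsCoherentInverseImage (S.inverseImage f))
    {X Y Z : S.CovanishingTopos K} (P : S.Presentation K A Z) {f : X ⟶ Z} {g : Y ⟶ Z}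
    (hf : P.IsPresented f) (hg : P.IsPresented g) :
    Nonempty (S.Presentation K A (pullback f g)) := by
  obtain ⟨k, hk, Z, hZ, e⟩ := P
  obtain ⟨⟨i, hi, X, hX, e₁⟩, r, a, ha⟩ := hf
  obtain ⟨⟨j, hj, Y, hY, e₂⟩, r', b, hb⟩ := hg
  dsimp only at r a ha r' b hb
  obtain ⟨l, p, q, hl, hpq⟩ := hA' r r' hi hj hk
  obtain ⟨a', ha'⟩ := S.exists_trans_comp (K := K) p r (p ≫ r) rfl a
  obtain ⟨b', hb'⟩ := S.exists_trans_comp (K := K) q r' (p ≫ r) hpq.w.symm b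
  have h := S.isPullback_extend hpq a b ha' hb' (IsPullback.of_hasPullback a' b')
  refine ⟨⟨l, hl, Limits.pullback a' b', isCoherent_pullback (epiFamiliesUniversal_sheaf _)
    (hA l hl) (htrans p hl hi X hX) (htrans q hl hj Y hY) (htrans (p ≫ r) hl hk Z hZ) a' b',
    (h.of_iso (Iso.refl _) e₁.symm e₂.symm e.symm 
      (fst' := ((S.extend K l).map (pullback.fst a' b') ≫ S.trans K p X) ≫ e₁.inv)
      (snd' := ((S.extend K l).map (pullback.snd a' b') ≫ S.trans K q Y) ≫ e₂.inv)
      (f' := f) (g' := g) (by simp) (by simp) ?_ ?_).isoPullback.symm⟩⟩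
  · rw [Iso.symm_hom, Iso.symm_hom, Iso.comp_inv_eq, Category.assoc, ha, Iso.inv_hom_id_assoc]
  · rw [Iso.symm_hom, Iso.symm_hom, Iso.comp_inv_eq, Category.assoc, hb, Iso.inv_hom_id_assoc]

/-- The extensions of the coherent sheaves on fibres form a coherent basis of the
co-vanishing topos. -/
lemma isCoherentBasis (hA : ∀ j, A j → IsAlgebraicTopos (S.FibreTopos j))
    (hdense : A.ι.IsCoverDense K) (hAK : ∀ j, A j → IsQuasiCompactInSite K j)
    (hpullback : ∀ ⦃i j k : I⦄ (f : i ⟶ k) (g : j ⟶ k), A i → A j → A k →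
      ∃ (l : I) (p : l ⟶ i) (q : l ⟶ j), A l ∧ IsPullback p q f g)
    (htrans : ∀ ⦃i j : I⦄ (f : i ⟶ j), A i → A j → IsCoherentInverseImage (S.inverseImage f)) :
    IsCoherentBasis (fun F : S.CovanishingTopos K ↦ Nonempty (S.Presentation K A F))
      (fun _ _ φ ↦ ∃ h, (Classical.choice h : S.Presentation K A _).IsPresented φ) where
  quasiCompact := by
    rintro F ⟨i, hi, X, hX, e⟩
    exact isQuasiCompact_of_iso (epiFamiliesUniversal_sheaf _)
      (isQuasiCompact_extend hA hdense hAK htrans hi hX.1) e.symm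
  covers u h := (S.isEpimorphicFamily_isPresented hA hdense (Classical.choice h) u).mono
    fun _ _ ha ↦ ⟨⟨ha.choose⟩, h, ha⟩
  generates := S.isEpimorphicFamily_presentation hA hdense
  pullback_mem := by
    -- Goodness refers to a presentation of the target chosen from its mere existence, so both
    -- morphisms are presented relative to the same presentation of `Z`.
    rintro X Y Z f g ⟨h, hf⟩ ⟨_, hg⟩
    exact Presentation.pullback S hA hpullback htrans _ hf hg

/-- Each section of the extension is locally a restriction of the section over the final object of
E, and any two maps to that object agree. -/
lemma nonempty_isTerminal_extend {i : I} (hi : IsTerminal i) :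
    Nonempty (IsTerminal ((S.extend K i).obj (⊤_ _))) := by
  let x := eta (incl i) (K := S.covanishingTopology K)
    (terminalSec (S.topology i) (⊤_ π.Fiber i))
  have key {U : E} (s : Sec ((S.extend K i).obj (⊤_ S.FibreTopos i)) U) :
      s = res (S.exists_hom_terminal hi U).some x := by
    apply sec_ext
    refine (loc_sheafPullback s).mono ?_
    rintro V t ⟨W, v, y, hy⟩
    rw [hy, eq_terminalSec y, ← eq_terminalSec (res (terminal.from W) (terminalSec _ _)),
      eta_res, res_res, res_res]
    congr 1
    exact S.hom_terminal_ext hi _ _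
  exact ⟨isTerminalOfSections _ _ fun U s ↦ key s⟩

end FibredSite

end Covanishing

theorem proposition5p16
    {I : Type u₁} [Category.{w} I] (K : GrothendieckTopology I) (hK : Covanishing.IsUSite K)
    [HasPullbacks I]
    {E : Type u₂} [Category.{w} E] (π : E ⥤ I) [π.IsFibered]
    [∀ i, HasFiniteLimits (π.Fiber i)] (S : Covanishing.FibredSite π)
    (I' : ObjectProperty I) (hI'_small : ObjectProperty.Small.{w} I')
    (hI'_generating : I'.ι.IsCoverDense K)
    (hI'_quasiCompact : ∀ i, I' i → Covanishing.IsQuasiCompactInSite K i)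
    (hI'_pullback : ∀ ⦃i j k : I⦄ (f : i ⟶ k) (g : j ⟶ k), I' i → I' j → I' k →
      ∃ (l : I) (p : l ⟶ i) (q : l ⟶ j), I' l ∧ IsPullback p q f g)
    (h_coherent : ∀ i, I' i → Covanishing.IsCoherentTopos (S.FibreTopos i))
    (h_transition : ∀ ⦃i j : I⦄ (f : i ⟶ j), I' i → I' j →
      Covanishing.IsCoherentInverseImage (S.inverseImage f)) :
    Covanishing.IsLocallyCoherentTopos (S.CovanishingTopos K) ∧
      ((∃ i, I' i ∧ Nonempty (IsTerminal i)) →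
        Covanishing.IsCoherentTopos (S.CovanishingTopos K)) := by
  have := Fact.mk hK
  have hA : ∀ j, I' j → Covanishing.IsAlgebraicTopos (S.FibreTopos j) :=
    fun j hj ↦ (h_coherent j hj).1
  have hT := Covanishing.epiFamiliesUniversal_sheaf (S.covanishingTopology K)
  have hB := S.isCoherentBasis hA hI'_generating hI'_quasiCompact hI'_pullback h_transition
  refine ⟨hB.isLocallyCoherentTopos hT, ?_⟩
  rintro ⟨i, hi, ⟨ht⟩⟩
  exact hB.isCoherentTopos hT ⟨⟨i, hi, _, (h_coherent i hi).2, Iso.refl _⟩⟩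
    (S.nonempty_isTerminal_extend ht).some
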